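/- Let $K$ be a field of characteristic zero, let $1\le d<n$, and let $A=(A_1,\dots,A_n)\in K^{d\times n}$ have rank $d$. Let $K\{\!\{t\}\!\}$ be the field of Puiseux series over $K$ (series in $t$ with rational exponents that have a common denominator), with its $t$-adic valuation and valuation ring $R$ of series without negative exponents. Let $w_1>w_2>\dots>w_{n-1}>0$ be rational numbers and let ${\bf c}=(t^{w_1},\dots,t^{w_{n-1}},1)$. For a matrix $B$ with $m$ columns and a vector ${\bf g}$ of length $m$ over a field, let $\mathcal L_{B,{\bf g}}$ be the span of the rows of $B$ and ${\bf g}$. The central sheet $\mathcal L_{B,{\bf g}}^{-1}$ is the Zariski closure of $\{(1/u_1,\dots,1/u_m) : u\in\mathcal L_{B,{\bf g}},\ u_j\neq 0 \text{ for all } j\}$, and $J_{B,{\bf g}}$ is the ideal of all polynomials that vanish on it. For an ideal $J\subset K\{\!\{t\}\!\}[x_1,\dots,x_n]$, let ${\rm in}(J)\subset K[x_1,\dots,x_n]$ be the ideal of its special fiber, that is, the set of reductions at $t=0$ of the elements of $J\cap R[x_1,\dots,x_n]$. Finally, $I_{{\rm num},r}(M)$ is the ideal generated by the numerators (in lowest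 terms) of the $r\times r$ minors of a matrix $M$ of rational functions. Then the ideal ${\rm in}(J_{A,{\bf c}})$ is radical. If moreover $A$ is generic, in the sense that any $d$ columns of $A$ are linearly independent, then $$ {\rm in}(J_{A,{\bf c}}) \;=\; \bigcap_{i=d}^{n-1} Q_i ,\qquad Q_i \;=\; I_{{\rm num},d+1}\begin{pmatrix} A_1 & A_2 & \cdots & A_i\\ x_1^{-1} & x_2^{-1} & \cdots & x_i^{-1}\end{pmatrix} + \langle x_{i+2},x_{i+3},\dots,x_n\rangle ,$$ all the ideals $Q_i$ are prime, and the central sheet degenerates into a reduced union of central sheets of smaller linear programs: $Q_i$ is the ideal of all polynomials that vanish on the central sheet of the program in $x_1,\dots,x_{i+1}$ with constraint matrix $(A_1,\dots,A_{i+1})$ and cost vector $(0,\dots,0,1)$, placed in the coordinate subspace $x_{i+2}=\dots=x_n=0$, and ${\rm in}(J_{A,{\bf c}})$ is the ideal of all polynomials that vanish on the union of these sheets for $i=d,\dots,n-1$. -/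

import Mathlib

open MvPolynomial

noncomputable section

/-! ### Puiseux series -/

/-- Exponents of `f` lie in `(1/N)ℤ`. -/
def HasDenominator {K : Type*} [Field K] (N : ℕ) (f : HahnSeries ℚ K) : Prop :=
  ∀ q ∈ f.support, ∃ z : ℤ, q = (z : ℚ) / N

theorem HasDenominator.mul_right {K : Type*} [Field K] {N : ℕ} {f : HahnSeries ℚ K}
    (h : HasDenominator N f) {M : ℕ} (hM : 0 < M) : HasDenominator (N * M) f := by
  intro q hq
  obtain ⟨z, rfl⟩ := h q hq
  refine ⟨z * M, ?_⟩
  have hM' : (M : ℚ) ≠ 0 := by exact_mod_cast hM.ne'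
  push_cast
  rw [mul_div_mul_right _ _ hM']

theorem HasDenominator.mul_left {K : Type*} [Field K] {N : ℕ} {f : HahnSeries ℚ K}
    (h : HasDenominator N f) {M : ℕ} (hM : 0 < M) : HasDenominator (M * N) f := by
  rw [mul_comm]; exact h.mul_right hM

/-- The map `ℤ → ℚ`, `z ↦ z / N`. -/
def divHom (N : ℕ) : ℤ →+ ℚ where
  toFun z := (z : ℚ) / N
  map_zero' := by simp
  map_add' a b := by push_cast; ring

theorem divHom_le {N : ℕ} (hN : 0 < N) (a b : ℤ) : divHom N a ≤ divHom N b ↔ a ≤ b := by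
  have hN' : (0 : ℚ) < N := by exact_mod_cast hN
  change (a : ℚ) / N ≤ (b : ℚ) / N ↔ _
  rw [div_le_div_iff_of_pos_right hN', Int.cast_le]

theorem divHom_injective {N : ℕ} (hN : 0 < N) : Function.Injective (divHom N) := fun a b h =>
  le_antisymm ((divHom_le hN a b).1 h.le) ((divHom_le hN b a).1 h.ge)

theorem hasDenominator_iff {K : Type*} [Field K] {N : ℕ} (hN : 0 < N) (f : HahnSeries ℚ K) :
    HasDenominator N f ↔
      f ∈ (HahnSeries.embDomainRingHom (R := K) (divHom N) (divHom_injective hN)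
        (divHom_le hN)).fieldRange := by
  constructor
  · intro h
    let g : HahnSeries ℤ K :=
      { coeff := fun z => f.coeff (divHom N z)
        isPWO_support' := by
          have h1 := f.isPWO_support
          intro s
          obtain ⟨a, b, hab, hle⟩ := h1 (fun k => ⟨divHom N (s k), (s k).2⟩)
          exact ⟨a, b, hab, (divHom_le hN _ _).1 hle⟩ }
    refine ⟨g, ?_⟩
    ext q
    simp only [HahnSeries.embDomainRingHom_apply]
    by_cases hq : ∃ z : ℤ, q = divHom N z
    · obtain ⟨z, rfl⟩ := hq
      exact HahnSeries.embDomain_coeff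
        (f := (⟨⟨divHom N, divHom_injective hN⟩, divHom_le hN _ _⟩ : ℤ ↪o ℚ)) (x := g) (a := z)
    · rw [HahnSeries.embDomain_of_notMem_range]
      · by_contra hne
        exact hq (h q (fun h0 => hne h0.symm))
      · rintro ⟨z, hz⟩
        exact hq ⟨z, hz.symm⟩
  · rintro ⟨g, rfl⟩ q hq
    by_contra hz
    apply hq
    simp only [HahnSeries.embDomainRingHom_apply]
    apply HahnSeries.embDomain_of_notMem_range
    rintro ⟨z, hz'⟩
    exact hz ⟨z, hz'.symm⟩

/-- The field `K{{t}}` of Puiseux series: formal series in `t` with well-ordered rational exponents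
having a common denominator. -/
def puiseux (K : Type*) [Field K] : Subfield (HahnSeries ℚ K) where
  carrier := {f | ∃ N : ℕ, 0 < N ∧ HasDenominator N f}
  zero_mem' := ⟨1, one_pos, fun q hq => absurd rfl hq⟩
  one_mem' := ⟨1, one_pos, (hasDenominator_iff one_pos _).2 (one_mem _)⟩
  add_mem' := by
    rintro f g ⟨N, hN, hf⟩ ⟨M, hM, hg⟩
    have h := Nat.mul_pos hN hM
    exact ⟨N * M, h, (hasDenominator_iff h _).2 (add_mem
      ((hasDenominator_iff h _).1 (hf.mul_right hM)) ((hasDenominator_iff h _).1 (hg.mul_left hN)))⟩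
  mul_mem' := by
    rintro f g ⟨N, hN, hf⟩ ⟨M, hM, hg⟩
    have h := Nat.mul_pos hN hM
    exact ⟨N * M, h, (hasDenominator_iff h _).2 (mul_mem
      ((hasDenominator_iff h _).1 (hf.mul_right hM)) ((hasDenominator_iff h _).1 (hg.mul_left hN)))⟩
  neg_mem' := by
    rintro f ⟨N, hN, hf⟩
    exact ⟨N, hN, (hasDenominator_iff hN _).2 (neg_mem ((hasDenominator_iff hN _).1 hf))⟩
  inv_mem' := by
    rintro f ⟨N, hN, hf⟩
    exact ⟨N, hN, (hasDenominator_iff hN _).2 (inv_mem ((hasDenominator_iff hN _).1 hf))⟩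

/-- The monomial `a t ^ q`. -/
def puiseuxMonomial {K : Type*} [Field K] (q : ℚ) (a : K) : puiseux K :=
  ⟨HahnSeries.single q a, q.den, q.pos, fun r hr => by
    have hr' : r = q := by
      by_contra hne
      exact hr (HahnSeries.coeff_single_of_ne hne)
    exact ⟨q.num, by rw [hr', Rat.num_div_den]⟩⟩

/-- The constants `K → K{{t}}`. -/
def puiseuxC (K : Type*) [Field K] : K →+* puiseux K :=
  (HahnSeries.C : K →+* HahnSeries ℚ K).codRestrict (puiseux K).toSubring
    (fun a => (puiseuxMonomial 0 a).2)

/-- Multiplying series without negative exponents multiplies their constant terms, and creates no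
negative exponents. -/
theorem coeff_mul_of_nonneg {K : Type*} [Field K] {f g : HahnSeries ℚ K}
    (hf : ∀ q < 0, f.coeff q = 0) (hg : ∀ q < 0, g.coeff q = 0) :
    (∀ q < 0, (f * g).coeff q = 0) ∧ (f * g).coeff 0 = f.coeff 0 * g.coeff 0 := by
  have hf' : ∀ q, f.coeff q ≠ 0 → 0 ≤ q := fun q h => not_lt.1 fun h' => h (hf q h')
  have hg' : ∀ q, g.coeff q ≠ 0 → 0 ≤ q := fun q h => not_lt.1 fun h' => h (hg q h')
  constructor
  · intro q hq
    rw [HahnSeries.coeff_mul]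
    refine Finset.sum_eq_zero fun p hp => ?_
    rw [Finset.mem_antidiagonal] at hp
    have h1 := hf' _ hp.1
    have h2 := hg' _ hp.2.1
    have h3 := hp.2.2
    linarith
  · rw [HahnSeries.coeff_mul]
    refine Finset.sum_eq_single (0, 0) (fun p hp hne => ?_) (fun hp => ?_)
    · rw [Finset.mem_antidiagonal] at hp
      have h1 := hf' _ hp.1
      have h2 := hg' _ hp.2.1
      have h3 := hp.2.2
      exact absurd (Prod.ext (by simp; linarith) (by simp; linarith)) hne
    · rw [Finset.mem_antidiagonal] at hp
      by_contra hne
      exact hp ⟨left_ne_zero_of_mul hne, right_ne_zero_of_mul hne, add_zero 0⟩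

/-- The valuation ring of `K{{t}}`: the Puiseux series without negative exponents. -/
def puiseuxIntegers (K : Type*) [Field K] : Subring (puiseux K) where
  carrier := {f | ∀ q < 0, (f : HahnSeries ℚ K).coeff q = 0}
  zero_mem' := fun _ _ => rfl
  one_mem' := fun q hq => by
    change (1 : HahnSeries ℚ K).coeff q = 0
    rw [HahnSeries.coeff_one, if_neg hq.ne]
  add_mem' := by
    intro f g hf hg q hq
    change ((f : HahnSeries ℚ K) + g).coeff q = 0
    rw [HahnSeries.coeff_add, hf q hq, hg q hq, add_zero]
  neg_mem' := by
    intro f hf q hq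
    change (-(f : HahnSeries ℚ K)).coeff q = 0
    rw [HahnSeries.coeff_neg, hf q hq, neg_zero]
  mul_mem' := fun hf hg => (coeff_mul_of_nonneg hf hg).1

/-- Evaluation at `t = 0`: the residue map from the valuation ring of `K{{t}}` to `K`. -/
def puiseuxAtZero (K : Type*) [Field K] : puiseuxIntegers K →+* K where
  toFun f := ((f : puiseux K) : HahnSeries ℚ K).coeff 0
  map_zero' := rfl
  map_one' := by
    change (1 : HahnSeries ℚ K).coeff 0 = 1
    rw [HahnSeries.coeff_one, if_pos rfl]
  map_add' f g := rfl
  map_mul' f g := (coeff_mul_of_nonneg f.2 g.2).2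

/-- The initial ideal (ideal of the special fiber) `in(J) = J|_{t=0}`: the reductions at `t = 0` of
all elements of `J` whose coefficients lie in the valuation ring. -/
def initialIdeal {K : Type*} [Field K] {σ : Type*} (J : Ideal (MvPolynomial σ (puiseux K))) :
    Ideal (MvPolynomial σ K) :=
  (J.comap (MvPolynomial.map (puiseuxIntegers K).subtype)).map
    (MvPolynomial.map (puiseuxAtZero K))

/-! ### Central sheets -/

/-- `L_{A,c}`: the span of the rows of `A` and the cost vector `c`. -/
def costSpace {F : Type*} [Field F] {d m : ℕ} (A : Matrix (Fin d) (Fin m) F) (c : Fin m → F) :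
    Submodule F (Fin m → F) :=
  Submodule.span F (insert c (Set.range A.row))

/-- The coordinatewise reciprocals of the vectors in `L_{A,c}` without zero coordinate. The central
sheet `L_{A,c}⁻¹` is the Zariski closure of this set. -/
def centralSheet {F : Type*} [Field F] {d m : ℕ} (A : Matrix (Fin d) (Fin m) F) (c : Fin m → F) :
    Set (Fin m → F) :=
  {x | ∃ u ∈ costSpace A c, (∀ j, u j ≠ 0) ∧ x = fun j => (u j)⁻¹}

/-- `J_{A,c}`: the ideal of all polynomials that vanish on the central sheet. -/
def centralSheetIdeal {F : Type*} [Field F] {d m : ℕ} (A : Matrix (Fin d) (Fin m) F)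
    (c : Fin m → F) : Ideal (MvPolynomial (Fin m) F) :=
  vanishingIdeal F (centralSheet A c)

/-- The cost vector `(t^{w_1}, …, t^{w_{n-1}}, 1)`. -/
def degeneratingCost (K : Type*) [Field K] {n : ℕ} (w : Fin (n - 1) → ℚ) : Fin n → puiseux K :=
  fun j => if h : (j : ℕ) < n - 1 then puiseuxMonomial (w ⟨j, h⟩) 1 else 1

/-! ### The pieces of the degeneration -/

/-- `I_{num,r}(M)`: the ideal generated by the numerators, in lowest terms, of the `r × r` minors of
a matrix `M` with `r` rows whose entries are rational functions. -/
def numMinors {K : Type*} [Field K] {σ : Type*} {r m : ℕ}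
    (M : Matrix (Fin r) (Fin m) (FractionRing (MvPolynomial σ K))) : Ideal (MvPolynomial σ K) :=
  Ideal.span {f | ∃ e : Fin r ↪o Fin m,
    f = IsFractionRing.num (MvPolynomial σ K) (M.submatrix id e).det}

/-- The matrix with the rows of `A` on top and the last row `(x_1⁻¹, …, x_n⁻¹)`. -/
def stackInv {K : Type*} [Field K] {d n : ℕ} (A : Matrix (Fin d) (Fin n) K) :
    Matrix (Fin (d + 1)) (Fin n) (FractionRing (MvPolynomial (Fin n) K)) :=
  Matrix.of (Fin.snoc (fun k j => algebraMap _ _ (C (A k j) : MvPolynomial (Fin n) K))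
    (fun j => (algebraMap (MvPolynomial (Fin n) K) (FractionRing _) (X j))⁻¹))

/-- `I_{num,d+1}(A_1 … A_i; x_1⁻¹ … x_i⁻¹) + ⟨x_{i+2}, …, x_n⟩`. Columns and variables are indexed
from `0`, so the first `i` have index `< i` and the variables in the second ideal have
index `≥ i + 1`. -/
def pieceIdeal {K : Type*} [Field K] {d n : ℕ} (A : Matrix (Fin d) (Fin n) K) (i : Fin n) :
    Ideal (MvPolynomial (Fin n) K) :=
  numMinors ((stackInv A).submatrix id (Fin.castLE i.isLt.le)) ⊔
    Ideal.span {f | ∃ j : Fin n, (i : ℕ) + 1 ≤ j ∧ f = X j}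

/-- The central sheet of the smaller linear program in the first `i + 1` variables, with constraint
matrix `(A_1 … A_{i+1})` and cost vector the last unit vector `(0, …, 0, 1)`, placed in the
coordinate subspace where all the other variables are zero. -/
def pieceSheet {K : Type*} [Field K] {d n : ℕ} (A : Matrix (Fin d) (Fin n) K) (i : Fin n) :
    Set (Fin n → K) :=
  {x | ∃ y ∈ centralSheet (A.submatrix id (Fin.castLE (Nat.succ_le_of_lt i.isLt)))
      (Pi.single (Fin.last (i : ℕ)) 1),
    (∀ j : Fin ((i : ℕ) + 1), x (Fin.castLE (Nat.succ_le_of_lt i.isLt) j) = y j) ∧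
      ∀ j : Fin n, (i : ℕ) + 1 ≤ j → x j = 0}

/-- A `d × n` matrix is generic if its matroid is uniform of rank `d`: any `d` of its columns are
linearly independent. -/
def IsGenericMatrix {K : Type*} [Field K] {d n : ℕ} (A : Matrix (Fin d) (Fin n) K) : Prop :=
  ∀ e : Fin d ↪o Fin n, (A.submatrix id e).det ≠ 0

end

/-! The engine is a valued form of the broken circuit theorem for reciprocals of a linear space `L`.
Exponents are ranked by the valuation of their coefficient, with ties broken by lex. A linear
relation on `L` gives a polynomial vanishing on the reciprocals; its leading monomial omits the
leading index of the relation, so the support of that monomial is a broken circuit. Conversely, a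
vanishing polynomial without broken circuits in its monomials is zero (`eq_zero_of_not_isBroken`, by
deletion and contraction at a pivot). A dimension count then shows that the leading exponent of
every vanishing polynomial contains a broken circuit (`isBroken_of_isLeadingExp`).

Over Puiseux series, the lex leading exponent of a reduction at `t = 0` is the valued leading
exponent of its lift. Hence the lex leading exponents of the initial ideal are recognised by their
supports alone. If `g ^ k` lies in the initial ideal, the leading exponent of `g` has the same
broken support, so its leading term can be cancelled within the ideal; descent along lex gives
radicality.

Over `K` with the trivial valuation, the same cancellation identifies each piece ideal with the
vanishing ideal of its sheet, and joining two points of the linear space by a line shows that it is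
prime. For the decomposition, every point of a piece lifts to a point of the sheet over Puiseux
series (`degIdeal_le_vanishingIdeal`). In the other direction, eliminating the cost vector between
two circuits puts `X m` times each circuit polynomial in smaller indices into the initial ideal
(`X_mul_circuitPoly_mem_degIdeal`). Primality of the pieces then lets an element of the intersection
be corrected one variable at a time (`iInf_pieceIdeal_le_degIdeal`). -/

noncomputable section

/-! ### Reciprocals of a linear space over a valued field: independence of monomials without broken
circuits. -/

section Reciprocal

set_option linter.unusedSectionVars false

variable {F : Type*} [Field F] {ι : Type*} [Fintype ι] [LinearOrder ι]
  {Γ₀ : Type*} [LinearOrderedCommGroupWithZero Γ₀]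

/-- The points `x` with `x j = (u j)⁻¹` for `j ∈ E` and `x j = 0` for `j ∉ E`, where `u ∈ L` has no
zero coordinate in `E`. -/
def reciprocalLocus (L : Submodule F (ι → F)) (E : Finset ι) : Set (ι → F) :=
  {x | ∃ u ∈ L, (∀ j ∈ E, u j ≠ 0) ∧ (∀ j ∈ E, x j = (u j)⁻¹) ∧ ∀ j ∉ E, x j = 0}

/-- `i` is the largest index at which the entry of `w` has maximal valuation. -/
def IsLeadingIndex (v : Valuation F Γ₀) (w : ι → F) (i : ι) : Prop :=
  w i ≠ 0 ∧ (∀ j, v (w j) ≤ v (w i)) ∧ ∀ j, i < j → v (w j) < v (w i)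

/-- `σ` contains a broken circuit of `L`: the support, without the leading index, of a nonzero
linear relation among the coordinates of `L` that are indexed by `E`. -/
def IsBroken (v : Valuation F Γ₀) (L : Submodule F (ι → F)) (E σ : Finset ι) : Prop :=
  ∃ (w : ι → F) (i : ι), (∀ u ∈ L, w ⬝ᵥ u = 0) ∧ (∀ j ∉ E, w j = 0) ∧ IsLeadingIndex v w i ∧
    ∀ j, w j ≠ 0 → j ≠ i → j ∈ σ

/-- The first index in `E` at which the entry of `u` has maximal valuation. -/
theorem exists_pivot (v : Valuation F Γ₀) (u : ι → F) (E : Finset ι) (h : ∃ j ∈ E, u j ≠ 0) :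
    ∃ e ∈ E, u e ≠ 0 ∧ (∀ j ∈ E, v (u j) ≤ v (u e)) ∧ ∀ j ∈ E, j < e → v (u j) < v (u e) := by
  obtain ⟨j₀, hj₀, hu⟩ := h
  obtain ⟨k, hk, hmax⟩ := E.exists_max_image (fun j => v (u j)) ⟨j₀, hj₀⟩
  have hne : (E.filter fun j => v (u j) = v (u k)).Nonempty := ⟨k, by simp [hk]⟩
  have hmem := Finset.min'_mem _ hne
  set e := Finset.min' _ hne with he
  rw [Finset.mem_filter] at hmem
  refine ⟨e, hmem.1, ?_, fun j hj => hmem.2 ▸ hmax j hj, fun j hj hlt => ?_⟩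
  · have h1 := hmax j₀ hj₀
    have h2 : 0 < v (u j₀) := by simpa [zero_lt_iff] using hu
    intro h0
    rw [h0, map_zero] at hmem
    exact absurd (h2.trans_le h1) (by simp [← hmem.2])
  · refine lt_of_le_of_ne (hmem.2 ▸ hmax j hj) fun heq => ?_
    exact absurd (Finset.min'_le _ j (by simp [hj, heq, hmem.2])) (not_le.2 hlt)

/-- If `e` led `w`, the term `w e * u e` would strictly dominate every other term of `w ⬝ᵥ u`:
before `e` because `u` is smaller there, after `e` because `w` is. The sum could then not be zero.
-/
theorem not_isLeadingIndex_pivot (v : Valuation F Γ₀) {u w : ι → F} {E : Finset ι} {e : ι}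
    (hue : u e ≠ 0) (hle : ∀ j ∈ E, v (u j) ≤ v (u e))
    (hlt : ∀ j ∈ E, j < e → v (u j) < v (u e)) (hw : w ⬝ᵥ u = 0) (hwE : ∀ j ∉ E, w j = 0) :
    ¬ IsLeadingIndex v w e := by
  rintro ⟨hwe, hwle, hwlt⟩
  have hsum : w e * u e = -∑ j ∈ Finset.univ.erase e, w j * u j := by
    rw [dotProduct, ← Finset.add_sum_erase _ _ (Finset.mem_univ e)] at hw
    exact eq_neg_of_add_eq_zero_left hw
  have hpos : v (w e) ≠ 0 := by simpa using hwe
  have hpos' : v (u e) ≠ 0 := by simpa using hue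
  have : v (∑ j ∈ Finset.univ.erase e, w j * u j) < v (w e * u e) := by
    refine v.map_sum_lt (by simp [hwe, hue]) fun j hj => ?_
    rw [map_mul, map_mul]
    by_cases hjE : j ∈ E
    · rcases lt_or_gt_of_ne (Finset.ne_of_mem_erase hj) with h | h
      · exact mul_lt_mul_of_le_of_lt_of_nonneg_of_pos (hwle j) (hlt j hjE h) zero_le (zero_lt_iff.2 hpos)
      · exact mul_lt_mul_of_lt_of_le_of_nonneg_of_pos (hwlt j h) (hle j hjE) zero_le (zero_lt_iff.2 hpos')
    · rw [hwE j hjE, map_zero, zero_mul]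
      exact zero_lt_iff.2 (mul_ne_zero hpos hpos')
  rw [hsum, Valuation.map_neg] at this
  exact lt_irrefl _ this

/-- The polynomial in `s` that arises from `f (1 / (u + s u'))` by clearing denominators. -/
def clearLine (f : MvPolynomial ι F) (E : Finset ι) (N : ι → ℕ) (u u' : ι → F) : Polynomial F :=
  ∑ a ∈ f.support, Polynomial.C (f.coeff a) *
    ∏ j ∈ E, (Polynomial.C (u j) + Polynomial.X * Polynomial.C (u' j)) ^ (N j - a j)

theorem eval_clearLine (f : MvPolynomial ι F) (E : Finset ι) (N : ι → ℕ) (u u' : ι → F) (s : F) :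
    (clearLine f E N u u').eval s =
      ∑ a ∈ f.support, f.coeff a * ∏ j ∈ E, (u j + s * u' j) ^ (N j - a j) := by
  simp [clearLine, Polynomial.eval_finsetSum, Polynomial.eval_prod, mul_comm s]

theorem prod_pow_mul_eval {f : MvPolynomial ι F} {E : Finset ι} {N : ι → ℕ}
    (hE : ∀ a ∈ f.support, a.support ⊆ E) (hN : ∀ a ∈ f.support, ∀ j ∈ E, a j ≤ N j)
    {x y : ι → F} (hy : ∀ j ∈ E, y j ≠ 0) (hx : ∀ j ∈ E, x j = (y j)⁻¹) :
    (∏ j ∈ E, y j ^ N j) * eval x f =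
      ∑ a ∈ f.support, f.coeff a * ∏ j ∈ E, y j ^ (N j - a j) := by
  rw [eval_eq, Finset.mul_sum]
  refine Finset.sum_congr rfl fun a ha => ?_
  rw [Finset.prod_subset (hE a ha) (fun j _ hj => by simp [Finsupp.notMem_support_iff.1 hj]),
    mul_left_comm, ← Finset.prod_mul_distrib]
  congr 1
  refine Finset.prod_congr rfl fun j hj => ?_
  rw [hx j hj, inv_pow, pow_sub₀ _ (hy j hj) (hN a ha j hj)]

theorem exists_mem_reciprocalLocus {L : Submodule F (ι → F)} {E : Finset ι} {y : ι → F}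
    (hy : y ∈ L) (hy0 : ∀ j ∈ E, y j ≠ 0) :
    ∃ x ∈ reciprocalLocus L E, ∀ j ∈ E, x j = (y j)⁻¹ :=
  ⟨fun j => if j ∈ E then (y j)⁻¹ else 0,
    ⟨y, hy, hy0, fun j hj => by simp [hj], fun j hj => by simp [hj]⟩, fun j hj => by simp [hj]⟩

/-- The product of the coordinates in `E` along the line `u + s u'`. -/
def lineProd (E : Finset ι) (u u' : ι → F) : Polynomial F :=
  ∏ j ∈ E, (Polynomial.C (u j) + Polynomial.X * Polynomial.C (u' j))

theorem eval_lineProd (E : Finset ι) (u u' : ι → F) (s : F) :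
    (lineProd E u u').eval s = ∏ j ∈ E, (u j + s * u' j) := by
  simp [lineProd, Polynomial.eval_prod, mul_comm s]

theorem lineProd_ne_zero {E : Finset ι} {u u' : ι → F} (h : ∀ j ∈ E, u j ≠ 0 ∨ u' j ≠ 0) :
    lineProd E u u' ≠ 0 := by
  refine Finset.prod_ne_zero_iff.2 fun j hj h0 => ?_
  have h1 := congrArg (fun p => Polynomial.coeff p 0) h0
  have h2 := congrArg (fun p => Polynomial.coeff p 1) h0
  simp [Polynomial.coeff_C] at h1 h2
  rcases h j hj with h | h
  · exact h h1
  · exact h h2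

/-- For all `s` off the zeros of `lineProd` the line gives a point of the locus, so the product of
the two polynomials vanishes at every `s` of an infinite field. -/
theorem clearLine_eq_zero [Infinite F] {L : Submodule F (ι → F)} {f : MvPolynomial ι F}
    {E : Finset ι} {N : ι → ℕ}
    (hE : ∀ a ∈ f.support, a.support ⊆ E) (hN : ∀ a ∈ f.support, ∀ j ∈ E, a j ≤ N j)
    (hf : ∀ x ∈ reciprocalLocus L E, eval x f = 0) {u u' : ι → F} (hu : u ∈ L) (hu' : u' ∈ L)
    (h : ∀ j ∈ E, u j ≠ 0 ∨ u' j ≠ 0) : clearLine f E N u u' = 0 := by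
  have hmul : lineProd E u u' * clearLine f E N u u' = 0 := by
    refine Polynomial.funext fun s => ?_
    rw [Polynomial.eval_mul, Polynomial.eval_zero, eval_lineProd, eval_clearLine]
    by_cases hs : ∀ j ∈ E, u j + s * u' j ≠ 0
    · obtain ⟨x, hx, hxE⟩ := exists_mem_reciprocalLocus (E := E) (y := fun j => u j + s * u' j)
        (L.add_mem hu (L.smul_mem s hu')) hs
      rw [← prod_pow_mul_eval hE hN hs hxE, hf x hx, mul_zero, mul_zero]
    · push Not at hs
      obtain ⟨j, hj, hj0⟩ := hs
      rw [Finset.prod_eq_zero hj hj0, zero_mul]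
  exact (mul_eq_zero.1 hmul).resolve_left (lineProd_ne_zero h)

/-- The coefficient of `X e ^ D` in `f`, as a polynomial in the other variables. -/
def powCoeff (f : MvPolynomial ι F) (e : ι) (D : ℕ) : MvPolynomial ι F :=
  ∑ a ∈ f.support with a e = D, monomial (a.erase e) (f.coeff a)

theorem erase_eq_erase {a b : ι →₀ ℕ} {e : ι} (h : a.erase e = b.erase e) (he : a e = b e) :
    a = b := by
  ext j
  by_cases hj : j = e
  · rw [hj, he]
  · have := DFunLike.congr_fun h j
    rwa [Finsupp.erase_ne hj, Finsupp.erase_ne hj] at this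

theorem coeff_powCoeff {f : MvPolynomial ι F} {e : ι} {a : ι →₀ ℕ} (ha : a ∈ f.support) :
    (powCoeff f e (a e)).coeff (a.erase e) = f.coeff a := by
  rw [powCoeff, coeff_sum, Finset.sum_eq_single a]
  · simp
  · intro b hb hne
    rw [coeff_monomial, if_neg]
    exact fun h => hne (erase_eq_erase h (Finset.mem_filter.1 hb).2)
  · intro h
    simp [mem_support_iff.1 ha] at h

theorem exists_of_mem_support_powCoeff {f : MvPolynomial ι F} {e : ι} {D : ℕ} {b : ι →₀ ℕ}
    (hb : b ∈ (powCoeff f e D).support) : ∃ a ∈ f.support, a e = D ∧ b = a.erase e := by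
  by_contra! hcon
  refine (mem_support_iff.1 hb) ?_
  rw [powCoeff, coeff_sum]
  refine Finset.sum_eq_zero fun a ha => ?_
  rw [Finset.mem_filter] at ha
  rw [coeff_monomial, if_neg]
  exact fun h => hcon a ha.1 ha.2 h.symm

/-- The line `u + s u'` is specialised at `s = 0`. When `u e = 0`, the coordinate `x e` goes to
infinity there, so only the top power of `X e` survives. When `D = 0` the variable `X e` does not
occur and the value of `u e` is irrelevant. -/
theorem eval_powCoeff_eq_zero [Infinite F] {L : Submodule F (ι → F)} {f : MvPolynomial ι F}
    {E : Finset ι} {e : ι} {D : ℕ} (he : e ∈ E) (hE : ∀ a ∈ f.support, a.support ⊆ E)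
    (hD : ∀ a ∈ f.support, a e ≤ D)
    (hf : ∀ x ∈ reciprocalLocus L E, eval x f = 0) {u' : ι → F} (hu' : u' ∈ L) (hu'e : u' e ≠ 0)
    {u : ι → F} (hu : u ∈ L) (hu0 : ∀ j ∈ E.erase e, u j ≠ 0) (hue : D ≠ 0 → u e = 0)
    {x : ι → F} (hx : ∀ j ∈ E.erase e, x j = (u j)⁻¹) : eval x (powCoeff f e D) = 0 := by
  -- The exponent at `e` must be exactly `D`: the factor `u e ^ (D - a e)` then kills the terms with
  -- `a e < D` and is `1` on the others.
  set N : ι → ℕ := fun j => if j = e then D else f.totalDegree with hNdef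
  have hN : ∀ a ∈ f.support, ∀ j ∈ E, a j ≤ N j := by
    intro a ha j _
    by_cases hj : j = e
    · simp only [hNdef, hj, if_true]; exact hD a ha
    · simp only [hNdef, hj, if_false]
      exact (monomial_le_degreeOf j ha).trans (degreeOf_le_totalDegree f j)
  have hP := clearLine_eq_zero hE hN hf hu hu' fun j hj => by
    by_cases hje : j = e
    · exact Or.inr (hje ▸ hu'e)
    · exact Or.inl (hu0 j (Finset.mem_erase.2 ⟨hje, hj⟩))
  have hP0 := congrArg (Polynomial.eval 0) hP
  rw [eval_clearLine, Polynomial.eval_zero] at hP0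
  have hprod : ∏ j ∈ E.erase e, u j ^ f.totalDegree ≠ 0 :=
    Finset.prod_ne_zero_iff.2 fun j hj => pow_ne_zero _ (hu0 j hj)
  refine (mul_eq_zero.1 (?_ : (∏ j ∈ E.erase e, u j ^ f.totalDegree) * _ = 0)).resolve_left hprod
  rw [← hP0, powCoeff, map_sum, Finset.mul_sum, Finset.sum_filter]
  refine Finset.sum_congr rfl fun a ha => ?_
  rw [← Finset.mul_prod_erase E _ he]
  simp only [zero_mul, add_zero]
  have hNe : N e = D := by simp [hNdef]
  rw [hNe]
  split_ifs with haD
  · rw [haD, Nat.sub_self, pow_zero, one_mul, eval_monomial, Finsupp.prod, mul_left_comm]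
    congr 1
    rw [Finset.prod_subset (s₁ := (a.erase e).support) (s₂ := E.erase e), ← Finset.prod_mul_distrib]
    · refine Finset.prod_congr rfl fun j hj => ?_
      have hje := Finset.ne_of_mem_erase hj
      have h1 : N j = f.totalDegree := by simp [hNdef, hje]
      rw [Finsupp.erase_ne hje, hx j hj, inv_pow, h1, pow_sub₀ _ (hu0 j hj)]
      exact h1 ▸ hN a ha j (Finset.mem_of_mem_erase hj)
    · rw [Finsupp.support_erase]
      exact Finset.erase_subset_erase _ (hE a ha)
    · intro j _ hj
      rw [Finsupp.notMem_support_iff.1 hj, pow_zero]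
  · have hlt : a e < D := lt_of_le_of_ne (hD a ha) haD
    rw [hue (by omega), zero_pow (by omega)]
    ring

/-- A relation on the hyperplane section `u e = 0` extends uniquely to `L` by an entry at `e`. As
`e` never leads a relation on `L`, the extension keeps its leading index, and only `e` may have to
be added to `σ`. -/
theorem isBroken_of_contraction {v : Valuation F Γ₀} {L : Submodule F (ι → F)} {E σ : Finset ι}
    {e : ι} (he : e ∈ E) {u' : ι → F} (hu' : u' ∈ L) (hu'e : u' e ≠ 0)
    (hpiv : ∀ w : ι → F, (∀ u ∈ L, w ⬝ᵥ u = 0) → (∀ j ∉ E, w j = 0) → ¬ IsLeadingIndex v w e)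
    (h : IsBroken v (L ⊓ LinearMap.ker (LinearMap.proj e)) (E.erase e) σ) :
    IsBroken v L E (insert e σ) := by
  obtain ⟨w, i, hw, hwE, ⟨hwi, hle, hlt⟩, hσ⟩ := h
  set c : F := -(w ⬝ᵥ u') / u' e with hc
  have hwe : w e = 0 := hwE e (Finset.notMem_erase e E)
  have hie : i ≠ e := fun h => hwi (h ▸ hwe)
  set w' : ι → F := Function.update w e c with hw'
  have hne : ∀ j, j ≠ e → w' j = w j := fun j hj => Function.update_of_ne hj _ _
  have hw'e : w' e = c := Function.update_self _ _ _
  have hdot : ∀ u : ι → F, w' ⬝ᵥ u = w ⬝ᵥ u + c * u e := by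
    intro u
    rw [dotProduct, dotProduct, ← Finset.add_sum_erase _ _ (Finset.mem_univ e),
      ← Finset.add_sum_erase Finset.univ (fun j => w j * u j) (Finset.mem_univ e), hwe, hw'e,
      zero_mul, zero_add, add_comm]
    congr 1
    exact Finset.sum_congr rfl fun j hj => by rw [hne j (Finset.ne_of_mem_erase hj)]
  have hperp : ∀ u ∈ L, w' ⬝ᵥ u = 0 := by
    -- Subtracting a multiple of `u'` moves `u` into the hyperplane section, and `c` was chosen so
    -- that `w'` kills `u'`.
    intro u hu
    have h1 := hw (u - (u e / u' e) • u') ⟨L.sub_mem hu (L.smul_mem _ hu'), by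
      simp [hu'e]⟩
    rw [dotProduct_sub, dotProduct_smul, sub_eq_zero, smul_eq_mul] at h1
    rw [hdot, h1, hc]
    field_simp
    ring
  have hsupp : ∀ j ∉ E, w' j = 0 := fun j hj => by
    rw [hne j (fun h => hj (h ▸ he)), hwE j (fun h => hj (Finset.mem_of_mem_erase h))]
  -- If the new entry were large enough to displace `i`, then `e` would lead `w'`, contrary to
  -- `hpiv`.
  have hvc : v c ≤ v (w i) ∧ (i < e → v c < v (w i)) := by
    by_contra hcon
    refine hpiv w' hperp hsupp ⟨?_, fun j => ?_, fun j hj => ?_⟩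
    · rw [hw'e]
      intro h0
      refine hcon ⟨by simp [h0], fun _ => ?_⟩
      rw [h0, map_zero]
      exact zero_lt_iff.2 (by simpa using hwi)
    all_goals
      rw [not_and_or, not_le, Classical.not_imp, not_lt] at hcon
      rw [hw'e]
    · by_cases hj : j = e
      · rw [hj, hw'e]
      · rw [hne j hj]
        exact (hle j).trans (hcon.elim le_of_lt And.right)
    · rw [hne j hj.ne']
      rcases hcon with h | h
      · exact (hle j).trans_lt h
      · exact (hlt j (h.1.trans hj)).trans_le h.2
  refine ⟨w', i, hperp, hsupp, ⟨?_, fun j => ?_, fun j hj => ?_⟩, fun j hj hji => ?_⟩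
  · rwa [hne i hie]
  · rw [hne i hie]
    by_cases hj : j = e
    · rw [hj, hw'e]; exact hvc.1
    · rw [hne j hj]; exact hle j
  · rw [hne i hie]
    by_cases hje : j = e
    · rw [hje, hw'e]; exact hvc.2 (hje ▸ hj)
    · rw [hne j hje]; exact hlt j hj
  · by_cases hje : j = e
    · exact hje ▸ Finset.mem_insert_self _ _
    · exact Finset.mem_insert_of_mem (hσ j (by rwa [← hne j hje]) hji)

theorem IsBroken.mono {v : Valuation F Γ₀} {L : Submodule F (ι → F)} {E E' σ σ' : Finset ι}
    (h : IsBroken v L E σ) (hE : E ⊆ E') (hσ : σ ⊆ σ') : IsBroken v L E' σ' := by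
  obtain ⟨w, i, hw, hwE, hi, hwσ⟩ := h
  exact ⟨w, i, hw, fun j hj => hwE j fun h => hj (hE h), hi, fun j h1 h2 => hσ (hwσ j h1 h2)⟩

/-- The index `j` is a loop; its broken circuit is empty and so lies in every set. -/
theorem isBroken_of_forall_eq_zero (v : Valuation F Γ₀) {L : Submodule F (ι → F)} {E : Finset ι}
    {j : ι} (hj : j ∈ E) (h : ∀ u ∈ L, u j = 0) (σ : Finset ι) : IsBroken v L E σ := by
  refine ⟨Pi.single j 1, j, fun u hu => by simp [h u hu], fun k hk => ?_, ⟨?_, ?_, ?_⟩, ?_⟩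
  · exact Pi.single_eq_of_ne (fun h : k = j => hk (h ▸ hj)) _
  · simp
  · intro k
    by_cases hk : k = j
    · rw [hk]
    · simp [Pi.single_eq_of_ne hk]
  · intro k hk
    simp [Pi.single_eq_of_ne hk.ne']
  · intro k hk hkj
    exact absurd (Pi.single_eq_of_ne hkj _) hk

/-- Polynomials all of whose monomials are supported on sets without broken circuits are determined
by their values on the reciprocal locus. -/
theorem eq_zero_of_not_isBroken [Infinite F] (v : Valuation F Γ₀) (E : Finset ι) :
    ∀ (L : Submodule F (ι → F)) (f : MvPolynomial ι F),
      (∀ a ∈ f.support, a.support ⊆ E ∧ ¬ IsBroken v L E a.support) →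
      (∀ x ∈ reciprocalLocus L E, eval x f = 0) → f = 0 := by
  induction E using Finset.strongInduction with
  | H E ih =>
  intro L f hsupp hf
  by_contra hne
  obtain ⟨a₁, ha₁⟩ := Finset.nonempty_iff_ne_empty.2 (mt support_eq_empty.1 hne)
  by_cases hloop : ∃ j ∈ E, ∀ u ∈ L, u j = 0
  · obtain ⟨j, hj, h0⟩ := hloop
    exact (hsupp a₁ ha₁).2 (isBroken_of_forall_eq_zero v hj h0 _)
  push Not at hloop
  rcases E.eq_empty_or_nonempty with rfl | ⟨j, hj⟩
  · have h0 : ∀ a ∈ f.support, a = 0 := fun a ha => by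
      simpa using (hsupp a ha).1
    have h1 := hf 0 ⟨0, L.zero_mem, by simp, by simp, by simp⟩
    rw [eval_eq, Finset.sum_eq_single_of_mem a₁ ha₁
      (fun b hb hba => absurd ((h0 b hb).trans (h0 a₁ ha₁).symm) hba), h0 a₁ ha₁] at h1
    rw [h0 a₁ ha₁] at ha₁
    exact mem_support_iff.1 ha₁ (by simpa using h1)
  obtain ⟨u', hu', hu'j⟩ := hloop j hj
  obtain ⟨e, he, hu'e, hle, hlt⟩ := exists_pivot v u' E ⟨j, hj, hu'j⟩
  obtain ⟨a₀, ha₀, hmax⟩ := f.support.exists_max_image (fun a => a e) ⟨a₁, ha₁⟩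
  have hpiv : ∀ w : ι → F, (∀ u ∈ L, w ⬝ᵥ u = 0) → (∀ j ∉ E, w j = 0) → ¬ IsLeadingIndex v w e :=
    fun w hw hwE => not_isLeadingIndex_pivot v hu'e hle hlt (hw u' hu') hwE
  have hE : ∀ a ∈ f.support, a.support ⊆ E := fun a ha => (hsupp a ha).1
  -- The top coefficient in `X e` satisfies the induction hypothesis on `E.erase e`: for the
  -- deletion of `e` if `X e` does not occur, and for the contraction otherwise. Yet it contains the
  -- nonzero coefficient of `a₀`.
  have hg : powCoeff f e (a₀ e) = 0 := by
    by_cases hD : a₀ e = 0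
    · refine ih _ (Finset.erase_ssubset he) L _ (fun b hb => ?_) fun x hx => ?_
      · obtain ⟨a, ha, hae, rfl⟩ := exists_of_mem_support_powCoeff hb
        rw [Finsupp.support_erase]
        exact ⟨Finset.erase_subset_erase _ (hE a ha), fun hbr =>
          (hsupp a ha).2 (hbr.mono (Finset.erase_subset _ _) (Finset.erase_subset _ _))⟩
      · obtain ⟨u, hu, hu0, hxu, -⟩ := hx
        exact eval_powCoeff_eq_zero he hE hmax hf hu' hu'e hu hu0 (fun h => absurd hD h) hxu
    · refine ih _ (Finset.erase_ssubset he) (L ⊓ LinearMap.ker (LinearMap.proj e)) _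
        (fun b hb => ?_) fun x hx => ?_
      · obtain ⟨a, ha, hae, rfl⟩ := exists_of_mem_support_powCoeff hb
        rw [Finsupp.support_erase]
        refine ⟨Finset.erase_subset_erase _ (hE a ha), fun hbr => (hsupp a ha).2 ?_⟩
        refine (isBroken_of_contraction he hu' hu'e hpiv hbr).mono subset_rfl ?_
        exact Finset.insert_subset (by simpa [hae] using hD) (Finset.erase_subset _ _)
      · obtain ⟨u, hu, hu0, hxu, -⟩ := hx
        exact eval_powCoeff_eq_zero he hE hmax hf hu' hu'e hu.1 hu0 (fun _ => hu.2) hxu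
  have := coeff_powCoeff (e := e) ha₀
  rw [hg, coeff_zero] at this
  exact mem_support_iff.1 ha₀ this.symm

end Reciprocal

/-! ### Leading exponents of the polynomials that vanish on the reciprocal locus. -/

section Relations

set_option linter.unusedSectionVars false

variable {F : Type*} [Field F] {ι : Type*} [Fintype ι] [LinearOrder ι]
  {Γ₀ : Type*} [LinearOrderedCommGroupWithZero Γ₀]

/-- The exponent vector of the squarefree monomial with support `T`. -/
def sqfreeExp (T : Finset ι) : ι →₀ ℕ := ∑ j ∈ T, Finsupp.single j 1

theorem sqfreeExp_apply (T : Finset ι) (k : ι) : sqfreeExp T k = if k ∈ T then 1 else 0 := by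
  simp [sqfreeExp, Finsupp.finsetSum_apply, Finsupp.single_apply]

theorem degree_sqfreeExp (T : Finset ι) : (sqfreeExp T).degree = T.card := by
  simp [sqfreeExp]

theorem sqfreeExp_le {T : Finset ι} {a : ι →₀ ℕ} (h : T ⊆ a.support) : sqfreeExp T ≤ a := by
  intro k
  rw [sqfreeExp_apply]
  split_ifs with hk
  · exact Nat.one_le_iff_ne_zero.2 (Finsupp.mem_support_iff.1 (h hk))
  · exact Nat.zero_le _

/-- In lex the first differing index decides. Omitting a larger index therefore gives a larger
monomial, which is why leading indices take the largest index among ties. -/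
theorem sqfreeExp_erase_lt {S : Finset ι} {i k : ι} (hk : k ∈ S) (h : k < i) :
    toLex (sqfreeExp (S.erase k)) < toLex (sqfreeExp (S.erase i)) := by
  refine Finsupp.Lex.lt_iff.2 ⟨k, fun l hl => ?_, ?_⟩
  · simp [sqfreeExp_apply, hl.ne, (hl.trans h).ne]
  · simp [sqfreeExp_apply, hk, h.ne]

theorem sqfreeExp_erase_injOn (S : Finset ι) {i k : ι} (hi : i ∈ S) (hk : k ∈ S)
    (h : sqfreeExp (S.erase i) = sqfreeExp (S.erase k)) : i = k := by
  rcases lt_trichotomy i k with hlt | rfl | hlt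
  · exact absurd (sqfreeExp_erase_lt hi hlt) (by simp [h])
  · rfl
  · exact absurd (sqfreeExp_erase_lt hk hlt) (by simp [h])

/-- The polynomial `∑ i ∈ S, w i * ∏ j ∈ S \ i, X j`, which vanishes at the reciprocals of the
vectors that satisfy the linear relation `w`. -/
def relationPoly {A : Type*} [CommSemiring A] (S : Finset ι) (w : ι → A) : MvPolynomial ι A :=
  ∑ i ∈ S, monomial (sqfreeExp (S.erase i)) (w i)

theorem map_relationPoly {A B : Type*} [CommSemiring A] [CommSemiring B] (φ : A →+* B)
    (S : Finset ι) (w : ι → A) :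
    MvPolynomial.map φ (relationPoly S w) = relationPoly S fun j => φ (w j) := by
  simp [relationPoly, map_sum, map_monomial]

theorem monomial_sqfreeExp {A : Type*} [CommSemiring A] (T : Finset ι) (c : A) :
    monomial (sqfreeExp T) c = C c * ∏ j ∈ T, X j := by
  rw [sqfreeExp, monomial_sum_index]; rfl

theorem coeff_relationPoly {A : Type*} [CommSemiring A] {S : Finset ι} (w : ι → A) {i : ι}
    (hi : i ∈ S) : (relationPoly S w).coeff (sqfreeExp (S.erase i)) = w i := by
  rw [relationPoly, coeff_sum, Finset.sum_eq_single_of_mem i hi]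
  · simp
  · intro k hk hki
    rw [coeff_monomial, if_neg fun h => hki (sqfreeExp_erase_injOn S hk hi h)]

theorem exists_of_coeff_relationPoly_ne_zero {A : Type*} [CommSemiring A] {S : Finset ι}
    {w : ι → A} {a : ι →₀ ℕ} (h : (relationPoly S w).coeff a ≠ 0) :
    ∃ i ∈ S, a = sqfreeExp (S.erase i) := by
  by_contra! hcon
  refine h ?_
  rw [relationPoly, coeff_sum]
  exact Finset.sum_eq_zero fun i hi => by
    rw [coeff_monomial, if_neg fun h => hcon i hi h.symm]

theorem eval_relationPoly {S : Finset ι} {w x u : ι → F} (hu : ∀ j ∈ S, u j ≠ 0)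
    (hx : ∀ j ∈ S, x j = (u j)⁻¹) (hw : ∑ j ∈ S, w j * u j = 0) :
    eval x (relationPoly S w) = 0 := by
  have : eval x (relationPoly S w) = (∏ j ∈ S, x j) * ∑ j ∈ S, w j * u j := by
    rw [relationPoly, map_sum, Finset.mul_sum]
    refine Finset.sum_congr rfl fun i hi => ?_
    rw [monomial_sqfreeExp, map_mul, eval_C, map_prod, ← Finset.mul_prod_erase S _ hi, hx i hi]
    have := hu i hi
    simp only [eval_X]
    field_simp
  rw [this, hw, mul_zero]

/-- `b` is the lexicographically largest exponent whose coefficient in `f` has maximal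
valuation. -/
def IsLeadingExp (v : Valuation F Γ₀) (f : MvPolynomial ι F) (b : ι →₀ ℕ) : Prop :=
  f.coeff b ≠ 0 ∧ (∀ a, v (f.coeff a) ≤ v (f.coeff b)) ∧
    ∀ a, toLex b < toLex a → v (f.coeff a) < v (f.coeff b)

theorem IsLeadingExp.monomial_mul {v : Valuation F Γ₀} {f : MvPolynomial ι F} {b : ι →₀ ℕ}
    (h : IsLeadingExp v f b) (c : ι →₀ ℕ) : IsLeadingExp v (monomial c 1 * f) (c + b) := by
  obtain ⟨h0, hle, hlt⟩ := h
  have hb : (monomial c 1 * f).coeff (c + b) = f.coeff b := by rw [coeff_monomial_mul, one_mul]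
  refine ⟨by rwa [hb], fun a => ?_, fun a ha => ?_⟩ <;> rw [hb, coeff_monomial_mul'] <;>
    split_ifs with hc
  · rw [one_mul]; exact hle _
  · simp
  · obtain ⟨a, rfl⟩ := exists_add_of_le hc
    rw [one_mul, add_tsub_cancel_left]
    exact hlt a (by simpa using ha)
  · rw [map_zero]; exact zero_lt_iff.2 (by simpa using h0)

theorem IsLeadingIndex.isLeadingExp {v : Valuation F Γ₀} {w : ι → F} {i : ι} {S : Finset ι}
    (h : IsLeadingIndex v w i) (hi : i ∈ S) :
    IsLeadingExp v (relationPoly S w) (sqfreeExp (S.erase i)) := by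
  have hi' := coeff_relationPoly w hi
  refine ⟨by rw [hi']; exact h.1, fun a => ?_, fun a ha => ?_⟩ <;> rw [hi'] <;>
    by_cases h0 : (relationPoly S w).coeff a = 0
  · rw [h0, map_zero]; exact zero_le
  · obtain ⟨k, hk, rfl⟩ := exists_of_coeff_relationPoly_ne_zero h0
    rw [coeff_relationPoly w hk]
    exact h.2.1 k
  · rw [h0, map_zero]; exact zero_lt_iff.2 (by simpa using h.1)
  · obtain ⟨k, hk, rfl⟩ := exists_of_coeff_relationPoly_ne_zero h0
    rw [coeff_relationPoly w hk]
    refine h.2.2 k ?_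
    by_contra hlt
    rcases eq_or_lt_of_le (not_lt.1 hlt) with rfl | hlt
    · exact lt_irrefl _ ha
    · exact lt_asymm ha (sqfreeExp_erase_lt hk hlt)

/-- Among the leading terms of maximal valuation in the sum, let `b` be the lex largest exponent. At
`b` every other summand is strictly smaller: if `a` is below `b`, because `b` lies beyond the
leading exponent of `h a`; if `a` is above `b`, because its own leading term is not maximal. -/
theorem sum_C_mul_ne_zero_of_isLeadingExp {v : Valuation F Γ₀} {I : Finset (ι →₀ ℕ)}
    {h : (ι →₀ ℕ) → MvPolynomial ι F} (hh : ∀ a ∈ I, IsLeadingExp v (h a) a)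
    {g : (ι →₀ ℕ) → F} (hg : ∃ a ∈ I, g a ≠ 0) : ∑ a ∈ I, C (g a) * h a ≠ 0 := by
  obtain ⟨a₁, ha₁, hga₁⟩ := hg
  obtain ⟨k, hk, hmax⟩ := I.exists_max_image (fun a => v (g a * (h a).coeff a)) ⟨a₁, ha₁⟩
  obtain ⟨b, hb, hbmax⟩ := (I.filter fun a => v (g a * (h a).coeff a) =
    v (g k * (h k).coeff k)).exists_max_image (fun a => toLex a) ⟨k, by simp [hk]⟩
  rw [Finset.mem_filter] at hb
  have hpos : 0 < v (g b * (h b).coeff b) := by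
    rw [hb.2]
    refine lt_of_lt_of_le ?_ (hmax a₁ ha₁)
    exact zero_lt_iff.2 (by simpa using ⟨hga₁, (hh a₁ ha₁).1⟩)
  have hgb : v (g b) ≠ 0 := by
    intro h0
    rw [map_mul, h0, zero_mul] at hpos
    exact lt_irrefl _ hpos
  intro h0
  have hc := congrArg (coeff b) h0
  simp only [coeff_sum, coeff_C_mul, coeff_zero] at hc
  rw [← Finset.add_sum_erase _ _ hb.1] at hc
  have hlt : v (∑ a ∈ I.erase b, g a * (h a).coeff b) < v (g b * (h b).coeff b) := by
    refine v.map_sum_lt hpos.ne' fun a ha => ?_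
    obtain ⟨hab, haI⟩ := Finset.mem_erase.1 ha
    have hle : v (g a * (h a).coeff a) ≤ v (g b * (h b).coeff b) := hb.2 ▸ hmax a haI
    rcases lt_or_gt_of_ne (a := toLex a) (b := toLex b) (by simpa using hab) with hl | hl
    · by_cases hga : g a = 0
      · simpa [hga] using hpos
      · refine lt_of_lt_of_le ?_ hle
        rw [map_mul, map_mul]
        exact mul_lt_mul_of_pos_left ((hh a haI).2.2 b hl) (zero_lt_iff.2 (by simpa using hga))
    · have hlt : v (g a * (h a).coeff a) < v (g b * (h b).coeff b) := by
        refine lt_of_le_of_ne hle fun heq => ?_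
        exact absurd (hbmax a (Finset.mem_filter.2 ⟨haI, heq.trans hb.2⟩)) (not_le.2 hl)
      refine lt_of_le_of_lt ?_ hlt
      rw [map_mul, map_mul]
      gcongr
      exact (hh a haI).2.1 b
  rw [eq_neg_of_add_eq_zero_left hc, Valuation.map_neg] at hlt
  exact lt_irrefl _ hlt

/-- A monomial multiple of the relation polynomial has leading exponent exactly `a`. The relation
polynomial is homogeneous, so the degree bound survives. -/
theorem exists_relation_of_isBroken {v : Valuation F Γ₀} {L : Submodule F (ι → F)}
    {E : Finset ι} {a : ι →₀ ℕ} (haE : a.support ⊆ E) (h : IsBroken v L E a.support) :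
    ∃ g : MvPolynomial ι F, IsLeadingExp v g a ∧ (∀ x ∈ reciprocalLocus L E, eval x g = 0) ∧
      ∀ c ∈ g.support, c.support ⊆ E ∧ c.degree ≤ a.degree := by
  classical
  obtain ⟨w, i, hw, hwE, hi, hwσ⟩ := h
  set S : Finset ι := Finset.univ.filter fun j => w j ≠ 0 with hS
  have hiS : i ∈ S := by simp [hS, hi.1]
  have hSE : S ⊆ E := fun j hj => by
    by_contra hjE
    exact (Finset.mem_filter.1 hj).2 (hwE j hjE)
  have hle : sqfreeExp (S.erase i) ≤ a := sqfreeExp_le fun j hj =>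
    hwσ j (Finset.mem_filter.1 (Finset.mem_of_mem_erase hj)).2 (Finset.ne_of_mem_erase hj)
  obtain ⟨c, rfl⟩ := exists_add_of_le hle
  rw [add_comm] at haE ⊢
  refine ⟨monomial c 1 * relationPoly S w, (hi.isLeadingExp hiS).monomial_mul c, ?_, ?_⟩
  · rintro x ⟨u, hu, hu0, hx, -⟩
    rw [map_mul, eval_relationPoly (fun j hj => hu0 j (hSE hj)) (fun j hj => hx j (hSE hj)),
      mul_zero]
    rw [← hw u hu, dotProduct]
    refine Finset.sum_subset (Finset.subset_univ _) fun j _ hj => ?_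
    have : w j = 0 := by simpa [hS] using hj
    rw [this, zero_mul]
  · intro b hb
    rw [mem_support_iff, coeff_monomial_mul'] at hb
    split_ifs at hb with hcb
    · obtain ⟨b, rfl⟩ := exists_add_of_le hcb
      rw [one_mul, add_tsub_cancel_left] at hb
      obtain ⟨k, hk, rfl⟩ := exists_of_coeff_relationPoly_ne_zero hb
      refine ⟨?_, ?_⟩
      · intro j hj
        rw [Finsupp.mem_support_iff, Finsupp.add_apply] at hj
        by_cases hcj : c j = 0
        · rw [hcj, zero_add, sqfreeExp_apply] at hj
          refine hSE ?_
          by_contra hjS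
          exact hj (if_neg fun h => hjS (Finset.mem_of_mem_erase h))
        · refine haE ?_
          rw [Finsupp.mem_support_iff, Finsupp.add_apply]
          omega
      · simp only [map_add, degree_sqfreeExp, Finset.card_erase_of_mem hk,
          Finset.card_erase_of_mem hiS, le_refl]
    · exact absurd rfl hb

/-- The leading monomial of a polynomial that vanishes on the reciprocal locus is divisible by a
broken circuit. -/
theorem isBroken_of_isLeadingExp [Infinite F] {v : Valuation F Γ₀} {L : Submodule F (ι → F)}
    {E : Finset ι} {f : MvPolynomial ι F} (hE : ∀ a ∈ f.support, a.support ⊆ E)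
    (hf : ∀ x ∈ reciprocalLocus L E, eval x f = 0) {b : ι →₀ ℕ} (hb : IsLeadingExp v f b) :
    IsBroken v L E b.support := by
  classical
  by_contra hbr
  have hfin := Finsupp.finite_of_degree_le (σ := ι) f.totalDegree
  set B : Finset (ι →₀ ℕ) := hfin.toFinset.filter
    fun a => a.support ⊆ E ∧ IsBroken v L E a.support with hB
  have hbB : b ∉ B := fun h => hbr (Finset.mem_filter.1 h).2.2
  have hex : ∀ a ∈ insert b B, ∃ g : MvPolynomial ι F, IsLeadingExp v g a ∧
      (∀ x ∈ reciprocalLocus L E, eval x g = 0) ∧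
      ∀ c ∈ g.support, c.support ⊆ E ∧ c.degree ≤ f.totalDegree := by
    intro a ha
    rcases Finset.mem_insert.1 ha with rfl | ha
    · exact ⟨f, hb, hf, fun c hc => ⟨hE c hc, by
        exact le_totalDegree hc⟩⟩
    · rw [hB, Finset.mem_filter, Set.Finite.mem_toFinset] at ha
      obtain ⟨g, h1, h2, h3⟩ := exists_relation_of_isBroken ha.2.1 ha.2.2
      exact ⟨g, h1, h2, fun c hc => ⟨(h3 c hc).1, (h3 c hc).2.trans ha.1⟩⟩
  choose! h hlead hvan hsupp using hex
  -- If `b` were not broken, `f` and one relation for each exponent in `B` would give one more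
  -- polynomial than there are coefficients indexed by `B`. Some nontrivial combination therefore
  -- has no broken exponents and is zero, although distinct leading exponents forbid this.
  have hdep : ¬ LinearIndependent F
      (fun (a : (insert b B : Finset (ι →₀ ℕ))) (c : B) => (h a).coeff (c : ι →₀ ℕ)) := by
    intro hli
    have := hli.fintype_card_le_finrank
    simp [Finset.card_insert_of_notMem hbB] at this
  obtain ⟨g, hg, ⟨a₀, ha₀⟩, hga₀⟩ := Fintype.not_linearIndependent_iff.1 hdep
  set g' : (ι →₀ ℕ) → F := fun a => if ha : a ∈ insert b B then g ⟨a, ha⟩ else 0 with hg'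
  refine sum_C_mul_ne_zero_of_isLeadingExp (g := g') (fun a ha => hlead a ha)
    ⟨a₀, ha₀, by simpa only [hg', dif_pos ha₀] using hga₀⟩ ?_
  refine eq_zero_of_not_isBroken v E L _ (fun c hc => ?_) fun x hx => ?_
  · have hc' : c.support ⊆ E ∧ c.degree ≤ f.totalDegree := by
      by_contra hcon
      refine mem_support_iff.1 hc ?_
      rw [coeff_sum]
      refine Finset.sum_eq_zero fun a ha => ?_
      rw [coeff_C_mul]
      by_cases h0 : (h a).coeff c = 0
      · rw [h0, mul_zero]
      · exact absurd (hsupp a ha c (mem_support_iff.2 h0)) hcon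
    refine ⟨hc'.1, fun hcbr => mem_support_iff.1 hc ?_⟩
    have hcB : c ∈ B := Finset.mem_filter.2 ⟨by simpa using hc'.2, hc'.1, hcbr⟩
    have := congrFun hg ⟨c, hcB⟩
    simp only [Finset.sum_apply, Pi.smul_apply, smul_eq_mul, Pi.zero_apply] at this
    rw [coeff_sum, ← Finset.sum_coe_sort, ← this]
    refine Finset.sum_congr rfl fun a _ => ?_
    rw [coeff_C_mul, hg']
    simp only [a.2, dif_pos]
  · rw [map_sum]
    exact Finset.sum_eq_zero fun a ha => by rw [map_mul, hvan a ha x hx, mul_zero]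

end Relations

/-! ### The `t`-adic valuation and reduction at `t = 0`. -/

section PuiseuxValuation

/-- The `t`-adic valuation on Puiseux series, in multiplicative notation. -/
def puiseuxValuation (K : Type*) [Field K] :
    Valuation (puiseux K) (Multiplicative (WithTop ℚ)ᵒᵈ) :=
  (AddValuation.toValuation (HahnSeries.addVal ℚ K)).comap (puiseux K).subtype

variable {K : Type*} [Field K]

theorem puiseuxValuation_le_one_iff (x : puiseux K) :
    puiseuxValuation K x ≤ 1 ↔ x ∈ puiseuxIntegers K := by
  change ((0 : ℚ) : WithTop ℚ) ≤ (x : HahnSeries ℚ K).orderTop ↔ _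
  rw [HahnSeries.le_orderTop_iff_forall]
  exact forall_congr' fun q => by simp

theorem puiseuxValuation_lt_one_iff (x : puiseux K) :
    puiseuxValuation K x < 1 ↔ ∀ q ≤ 0, (x : HahnSeries ℚ K).coeff q = 0 := by
  rw [← not_le]
  change ¬ ((x : HahnSeries ℚ K).orderTop ≤ ((0 : ℚ) : WithTop ℚ)) ↔ _
  constructor
  · intro h q hq
    exact HahnSeries.coeff_eq_zero_of_lt_orderTop
      (lt_of_le_of_lt (WithTop.coe_le_coe.2 hq) (not_le.1 h))
  · intro h hle
    have hx : (x : HahnSeries ℚ K) ≠ 0 := by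
      rintro h0
      simp [h0] at hle
    rw [← HahnSeries.order_eq_orderTop_of_ne_zero hx, WithTop.coe_le_coe] at hle
    exact HahnSeries.coeff_order_eq_zero.not.2 hx (h _ hle)

theorem puiseuxValuation_lt_one_iff_atZero (r : puiseuxIntegers K) :
    puiseuxValuation K (r : puiseux K) < 1 ↔ puiseuxAtZero K r = 0 := by
  rw [puiseuxValuation_lt_one_iff]
  refine ⟨fun h => h 0 le_rfl, fun h q hq => ?_⟩
  rcases hq.lt_or_eq with hq | rfl
  · exact r.2 q hq
  · exact h

theorem puiseuxValuation_eq_one {r : puiseuxIntegers K} (h : puiseuxAtZero K r ≠ 0) :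
    puiseuxValuation K (r : puiseux K) = 1 :=
  le_antisymm ((puiseuxValuation_le_one_iff _).2 r.2)
    (not_lt.1 ((puiseuxValuation_lt_one_iff_atZero r).not.2 h))

/-- The constants as elements of the valuation ring. -/
def puiseuxIntegersC (K : Type*) [Field K] : K →+* puiseuxIntegers K :=
  (puiseuxC K).codRestrict (puiseuxIntegers K) fun a q hq => by
    change (HahnSeries.single 0 a).coeff q = 0
    exact HahnSeries.coeff_single_of_ne hq.ne

theorem puiseuxAtZero_puiseuxIntegersC (a : K) :
    puiseuxAtZero K (puiseuxIntegersC K a) = a := HahnSeries.coeff_single_same 0 a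

theorem mem_initialIdeal_iff {σ : Type*} {J : Ideal (MvPolynomial σ (puiseux K))}
    {g : MvPolynomial σ K} :
    g ∈ initialIdeal J ↔ ∃ h : MvPolynomial σ (puiseuxIntegers K),
      MvPolynomial.map (puiseuxIntegers K).subtype h ∈ J ∧
        MvPolynomial.map (puiseuxAtZero K) h = g := by
  rw [initialIdeal, Ideal.mem_map_iff_of_surjective _ (MvPolynomial.map_surjective _
    fun a => ⟨_, puiseuxAtZero_puiseuxIntegersC a⟩)]
  rfl

end PuiseuxValuation

/-! ### Radicality of the initial ideal. -/

section Radical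

variable {K : Type*} [Field K] {ι : Type*} [Fintype ι] [LinearOrder ι]

/-- The valuation that is `1` on all nonzero elements. -/
def trivialValuation (K : Type*) [Field K] : Valuation K (WithZero (Multiplicative ℤ)) := by
  classical exact 1

theorem trivialValuation_of_ne_zero {x : K} (hx : x ≠ 0) : trivialValuation K x = 1 := by
  classical exact Valuation.one_apply_of_ne_zero hx

theorem trivialValuation_lt_iff {x y : K} (hy : y ≠ 0) :
    trivialValuation K x < trivialValuation K y ↔ x = 0 := by
  rw [trivialValuation_of_ne_zero hy]
  refine ⟨fun h => ?_, fun h => by simp [h]⟩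
  by_contra hx
  rw [trivialValuation_of_ne_zero hx] at h
  exact lt_irrefl _ h

theorem trivialValuation_le {x y : K} (hy : y ≠ 0) :
    trivialValuation K x ≤ trivialValuation K y := by
  rw [trivialValuation_of_ne_zero hy]
  by_cases hx : x = 0
  · simp [hx]
  · rw [trivialValuation_of_ne_zero hx]

theorem isLeadingExp_degree {g : MvPolynomial ι K} (hg : g ≠ 0) :
    IsLeadingExp (trivialValuation K) g (MonomialOrder.lex.degree g) := by
  have h := MonomialOrder.lex.coeff_degree_ne_zero_iff.2 hg
  exact ⟨h, fun a => trivialValuation_le h, fun a ha => (trivialValuation_lt_iff h).2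
    (MonomialOrder.lex.coeff_eq_zero_of_lt (MonomialOrder.lex_lt_iff.2 ha))⟩

theorem IsLeadingExp.degree_eq {g : MvPolynomial ι K} {b : ι →₀ ℕ}
    (h : IsLeadingExp (trivialValuation K) g b) : MonomialOrder.lex.degree g = b := by
  refine MonomialOrder.lex.toSyn.injective (le_antisymm ?_ ?_)
  · by_contra hlt
    rw [not_le, MonomialOrder.lex_lt_iff] at hlt
    refine MonomialOrder.lex.coeff_degree_ne_zero_iff.2 (fun h0 => h.1 (by simp [h0]))
      ((trivialValuation_lt_iff h.1).1 (h.2.2 _ hlt))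
  · exact MonomialOrder.lex.le_degree (mem_support_iff.2 h.1)

/-- Coefficients with nonzero reduction have valuation `1`, the maximum possible; those beyond the
lex degree of the reduction vanish at `t = 0` and so have valuation less than `1`. -/
theorem isLeadingExp_map_subtype {h : MvPolynomial ι (puiseuxIntegers K)}
    (hg : MvPolynomial.map (puiseuxAtZero K) h ≠ 0) :
    IsLeadingExp (puiseuxValuation K) (MvPolynomial.map (puiseuxIntegers K).subtype h)
      (MonomialOrder.lex.degree (MvPolynomial.map (puiseuxAtZero K) h)) := by
  have h0 := MonomialOrder.lex.coeff_degree_ne_zero_iff.2 hg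
  rw [coeff_map] at h0
  have h1 := puiseuxValuation_eq_one h0
  refine ⟨?_, fun a => ?_, fun a ha => ?_⟩ <;> simp only [coeff_map, Subring.subtype_apply]
  · intro h2
    rw [h2, map_zero] at h1
    exact zero_ne_one h1
  · rw [h1, puiseuxValuation_le_one_iff]
    exact (coeff a h).2
  · rw [h1, puiseuxValuation_lt_one_iff_atZero, ← coeff_map]
    exact MonomialOrder.lex.coeff_eq_zero_of_lt (MonomialOrder.lex_lt_iff.2 ha)

/-- A set of polynomials is contained in an ideal `I` if leading terms of its members can always be
cancelled, within the set, by members of `I`. -/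
theorem subset_of_cancel_leadingTerm {I : Ideal (MvPolynomial ι K)} {S : Set (MvPolynomial ι K)}
    (hS : ∀ g ∈ S, g ≠ 0 → ∃ r ∈ I,
      IsLeadingExp (trivialValuation K) r (MonomialOrder.lex.degree g) ∧
      ∀ c : K, g - C c * r ∈ S) : S ⊆ I := by
  have key : ∀ (s : (MonomialOrder.lex (σ := ι)).syn) (g : MvPolynomial ι K), g ∈ S →
      MonomialOrder.lex.toSyn (MonomialOrder.lex.degree g) = s → g ∈ I := by
    intro s
    induction s using WellFoundedLT.induction with
    | ind s ih =>
    intro g hg hs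
    by_cases hg0 : g = 0
    · rw [hg0]; exact I.zero_mem
    obtain ⟨r, hr, hlead, hsub⟩ := hS g hg hg0
    have hdeg := hlead.degree_eq
    set d := MonomialOrder.lex.degree g with hd
    set c := g.coeff d / r.coeff d with hc
    have hcoeff : (g - C c * r).coeff d = 0 := by
      rw [coeff_sub, coeff_C_mul, hc, div_mul_cancel₀ _ hlead.1, sub_self]
    suffices h : g - C c * r ∈ I by
      have := I.add_mem h (I.mul_mem_left (C c) hr)
      rwa [sub_add_cancel] at this
    by_cases h0 : g - C c * r = 0
    · rw [h0]; exact I.zero_mem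
    refine ih _ ?_ _ (hsub c) rfl
    rw [← hs]
    have hne := MonomialOrder.lex.coeff_degree_ne_zero_iff.2 h0
    set d' := MonomialOrder.lex.degree (g - C c * r) with hd'
    refine lt_of_le_of_ne ?_ fun heq => ?_
    · by_contra hlt
      rw [not_le] at hlt
      refine hne ?_
      rw [coeff_sub, coeff_C_mul, MonomialOrder.lex.coeff_eq_zero_of_lt hlt,
        MonomialOrder.lex.coeff_eq_zero_of_lt (hdeg.symm ▸ hlt), mul_zero, sub_zero]
    · rw [MonomialOrder.lex.toSyn.injective heq] at hne
      exact hne hcoeff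
  exact fun g hg => key _ g hg rfl

/-- Normalized relations reduce at `t = 0` to elements of the initial ideal. -/
theorem exists_mem_initialIdeal_of_isBroken {L : Submodule (puiseux K) (ι → puiseux K)}
    {a : ι →₀ ℕ} (h : IsBroken (puiseuxValuation K) L Finset.univ a.support) :
    ∃ r ∈ initialIdeal (vanishingIdeal (puiseux K) (reciprocalLocus L Finset.univ)),
      IsLeadingExp (trivialValuation K) r a := by
  classical
  obtain ⟨w, i, hw, -, ⟨hwi, hle, hlt⟩, hwσ⟩ := h
  set S : Finset ι := Finset.univ.filter fun j => w j ≠ 0 with hS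
  have hiS : i ∈ S := by simp [hS, hwi]
  obtain ⟨c, rfl⟩ := exists_add_of_le (sqfreeExp_le fun j hj =>
    hwσ j (Finset.mem_filter.1 (Finset.mem_of_mem_erase hj)).2 (Finset.ne_of_mem_erase hj) :
      sqfreeExp (S.erase i) ≤ a)
  have hvi : 0 < puiseuxValuation K (w i) := zero_lt_iff.2 (by simpa using hwi)
  -- Division by the entry of largest valuation makes the relation integral; at `t = 0` the entries
  -- beyond `i` vanish and the entry at `i` is `1`.
  have hint : ∀ j, w j / w i ∈ puiseuxIntegers K := fun j => by
    rw [← puiseuxValuation_le_one_iff, map_div₀]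
    exact (div_le_one₀ hvi).2 (hle j)
  set W : ι → puiseuxIntegers K := fun j => ⟨w j / w i, hint j⟩ with hW
  have hWi : W i = 1 := Subtype.ext (div_self hwi)
  have hlead : IsLeadingIndex (trivialValuation K) (fun j => puiseuxAtZero K (W j)) i := by
    have h1 : puiseuxAtZero K (W i) ≠ 0 := by rw [hWi, map_one]; exact one_ne_zero
    refine ⟨h1, fun j => trivialValuation_le h1, fun j hj => (trivialValuation_lt_iff h1).2 ?_⟩
    rw [← puiseuxValuation_lt_one_iff_atZero, map_div₀]
    exact (div_lt_one₀ hvi).2 (hlt j hj)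
  refine ⟨monomial c 1 * relationPoly S fun j => puiseuxAtZero K (W j), ?_, ?_⟩
  · refine mem_initialIdeal_iff.2 ⟨monomial c 1 * relationPoly S W, ?_, ?_⟩
    · rw [map_mul, map_relationPoly]
      refine Ideal.mul_mem_left _ _ (mem_vanishingIdeal_iff.2 ?_)
      rintro x ⟨u, hu, hu0, hx, -⟩
      rw [aeval_eq_eval]
      refine eval_relationPoly (u := u) (fun j _ => hu0 j (Finset.mem_univ j))
        (fun j _ => hx j (Finset.mem_univ j)) ?_
      have h1 : ∑ j ∈ S, w j * u j = 0 := by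
        rw [← hw u hu, dotProduct]
        refine Finset.sum_subset (Finset.subset_univ _) fun j _ hj => ?_
        have : w j = 0 := by simpa [hS] using hj
        rw [this, zero_mul]
      calc ∑ j ∈ S, w j / w i * u j = (∑ j ∈ S, w j * u j) / w i := by
            rw [Finset.sum_div]
            exact Finset.sum_congr rfl fun j _ => by ring
        _ = 0 := by rw [h1, zero_div]
    · rw [map_mul, map_relationPoly, map_monomial, map_one]
  · rw [add_comm]
    exact (hlead.isLeadingExp hiS).monomial_mul c

theorem isRadical_initialIdeal_reciprocalLocus [CharZero K]
    (L : Submodule (puiseux K) (ι → puiseux K)) :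
    (initialIdeal (vanishingIdeal (puiseux K) (reciprocalLocus L Finset.univ))).IsRadical := by
  set I := initialIdeal (vanishingIdeal (puiseux K) (reciprocalLocus L Finset.univ)) with hI
  have : Infinite (puiseux K) := Infinite.of_injective _ (puiseuxC K).injective
  refine subset_of_cancel_leadingTerm (S := (I.radical : Set (MvPolynomial ι K))) fun g hg hg0 => ?_
  obtain ⟨k, hk⟩ := hg
  obtain ⟨h, hJ, hmap⟩ := mem_initialIdeal_iff.1 hk
  have hbr : IsBroken (puiseuxValuation K) L Finset.univ
      (MonomialOrder.lex.degree (g ^ k)).support := by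
    rw [← hmap]
    refine isBroken_of_isLeadingExp (fun a _ => Finset.subset_univ _) (fun x hx => ?_)
      (isLeadingExp_map_subtype (hmap ▸ pow_ne_zero k hg0))
    have := mem_vanishingIdeal_iff.1 hJ x hx
    rwa [aeval_eq_eval] at this
  -- Being broken depends only on the support, which does not grow when an exponent is multiplied by
  -- `k`.
  rw [MonomialOrder.degree_pow] at hbr
  obtain ⟨r, hr, hlead⟩ := exists_mem_initialIdeal_of_isBroken
    (hbr.mono subset_rfl Finsupp.support_smul)
  exact ⟨r, hr, hlead, fun c => Ideal.sub_mem _ ⟨k, hk⟩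
    (Ideal.mul_mem_left _ _ (Ideal.le_radical hr))⟩

end Radical

/-! ### Vanishing ideals of reciprocal loci over the ground field: leading terms, nonemptiness,
primality. -/

section Vanishing

set_option linter.unusedSectionVars false

variable {K : Type*} [Field K] {ι : Type*} [Fintype ι] [LinearOrder ι]

/-- The part of `g` that involves only the variables in `E`. -/
def restrictVars (E : Finset ι) (g : MvPolynomial ι K) : MvPolynomial ι K :=
  ∑ a ∈ g.support with a.support ⊆ E, monomial a (g.coeff a)

theorem coeff_restrictVars (E : Finset ι) (g : MvPolynomial ι K) (a : ι →₀ ℕ) :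
    (restrictVars E g).coeff a = if a.support ⊆ E then g.coeff a else 0 := by
  simp only [restrictVars, coeff_sum, coeff_monomial, Finset.sum_ite_eq', Finset.mem_filter,
    mem_support_iff]
  split_ifs <;> simp_all

theorem support_subset_of_mem_restrictVars {E : Finset ι} {g : MvPolynomial ι K} {a : ι →₀ ℕ}
    (ha : a ∈ (restrictVars E g).support) : a.support ⊆ E := by
  by_contra h
  exact mem_support_iff.1 ha (by rw [coeff_restrictVars, if_neg h])

theorem eval_restrictVars {E : Finset ι} (g : MvPolynomial ι K) {x : ι → K}
    (hx : ∀ j ∉ E, x j = 0) : eval x (restrictVars E g) = eval x g := by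
  rw [restrictVars, map_sum, Finset.sum_filter, eval_eq]
  refine Finset.sum_congr rfl fun a _ => ?_
  split_ifs with h
  · rw [eval_monomial, Finsupp.prod]
  · obtain ⟨j, hj, hjE⟩ := Finset.not_subset.1 h
    rw [Finset.prod_eq_zero hj (by rw [hx j hjE, zero_pow (Finsupp.mem_support_iff.1 hj)]),
      mul_zero]

theorem isBroken_degree_of_mem_vanishingIdeal [Infinite K] {L : Submodule K (ι → K)}
    {E : Finset ι} {g : MvPolynomial ι K} (hg : g ∈ vanishingIdeal K (reciprocalLocus L E))
    (hg0 : g ≠ 0) (hE : (MonomialOrder.lex.degree g).support ⊆ E) :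
    IsBroken (trivialValuation K) L E (MonomialOrder.lex.degree g).support := by
  refine isBroken_of_isLeadingExp (f := restrictVars E g)
    (fun a ha => support_subset_of_mem_restrictVars ha) (fun x hx => ?_) ?_
  · rw [eval_restrictVars g hx.choose_spec.2.2.2, ← aeval_eq_eval]
    exact mem_vanishingIdeal_iff.1 hg x hx
  · obtain ⟨h0, -, hlt⟩ := isLeadingExp_degree hg0
    have h : (restrictVars E g).coeff (MonomialOrder.lex.degree g) =
        g.coeff (MonomialOrder.lex.degree g) := by rw [coeff_restrictVars, if_pos hE]
    refine ⟨by rwa [h], fun a => by rw [h]; exact trivialValuation_le h0, fun a ha => ?_⟩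
    rw [h, trivialValuation_lt_iff h0, coeff_restrictVars,
      (trivialValuation_lt_iff h0).1 (hlt a ha), ite_self]

theorem reciprocalLocus_nonempty [Infinite K] {L : Submodule K (ι → K)} {E : Finset ι}
    (h : ∀ j ∈ E, ∃ u ∈ L, u j ≠ 0) : (reciprocalLocus L E).Nonempty := by
  by_contra hne
  rw [Set.not_nonempty_iff_eq_empty] at hne
  -- If the locus were empty, `1` would vanish on it and the empty set would be broken. The relation
  -- `w` would then have only one nonzero entry, so that `i` would be a loop.
  obtain ⟨w, i, hw, hwE, hi, hwσ⟩ := isBroken_degree_of_mem_vanishingIdeal (L := L) (E := E) (g := 1)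
    (by rw [hne, vanishingIdeal_empty]; trivial) one_ne_zero (by simp)
  have hiE : i ∈ E := by
    by_contra hiE
    exact hi.1 (hwE i hiE)
  obtain ⟨u, hu, hui⟩ := h i hiE
  have h0 := hw u hu
  rw [dotProduct, Finset.sum_eq_single i] at h0
  · exact mul_ne_zero hi.1 hui h0
  · intro j _ hji
    by_contra hj
    simpa using hwσ j (left_ne_zero_of_mul hj) hji
  · simp

/-- Two points where `f` and `g` do not vanish come from vectors `u`, `u'` of `L`. Along the line
from `u` (`s = 0`) to `u'` (`s = 1`), the cleared polynomials of `f` and `g` are nonzero in one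
variable, while vanishing of `f * g` forces one of them to be zero. -/
theorem isPrime_vanishingIdeal_reciprocalLocus [Infinite K] {L : Submodule K (ι → K)}
    {E : Finset ι} (hne : (reciprocalLocus L E).Nonempty) :
    (vanishingIdeal K (reciprocalLocus L E)).IsPrime := by
  refine ⟨fun htop => ?_, fun {f g} hfg => ?_⟩
  · obtain ⟨x, hx⟩ := hne
    have := mem_vanishingIdeal_iff.1 ((Ideal.eq_top_iff_one _).1 htop) x hx
    simp at this
  by_contra! hcon
  simp only [mem_vanishingIdeal_iff, not_forall, aeval_eq_eval] at hcon
  obtain ⟨⟨x, hx, hfx⟩, y, hy, hgy⟩ := hcon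
  obtain ⟨u, hu, hu0, hxu, hxE⟩ := hx
  obtain ⟨u', hu', hu0', hyu, hyE⟩ := hy
  have hsupp : ∀ p : MvPolynomial ι K, ∀ a ∈ (restrictVars E p).support, a.support ⊆ E :=
    fun p a => support_subset_of_mem_restrictVars
  have hdeg : ∀ p : MvPolynomial ι K, ∀ a ∈ (restrictVars E p).support, ∀ j ∈ E,
      a j ≤ (fun _ : ι => (restrictVars E p).totalDegree) j := fun p a ha j _ =>
    (monomial_le_degreeOf j ha).trans (degreeOf_le_totalDegree _ j)
  set P : MvPolynomial ι K → Polynomial K := fun p => clearLine (restrictVars E p) E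
    (fun _ => (restrictVars E p).totalDegree) u (u' - u) with hP
  have heval : ∀ (p : MvPolynomial ι K) (s : K) (z : ι → K),
      (∀ j ∈ E, u j + s * (u' - u) j ≠ 0) → (∀ j ∈ E, z j = (u j + s * (u' - u) j)⁻¹) →
      (∀ j ∉ E, z j = 0) → (P p).eval s =
        (∏ j ∈ E, (u j + s * (u' - u) j) ^ (restrictVars E p).totalDegree) * eval z p := by
    intro p s z h1 h2 h3
    rw [hP, eval_clearLine, ← prod_pow_mul_eval (hsupp p) (hdeg p) h1 h2, eval_restrictVars p h3]
  have hzero : lineProd E u (u' - u) * (P f * P g) = 0 := by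
    refine Polynomial.funext fun s => ?_
    rw [Polynomial.eval_mul, Polynomial.eval_zero, eval_lineProd, Polynomial.eval_mul]
    by_cases hs : ∀ j ∈ E, u j + s * (u' - u) j ≠ 0
    · have hz : (fun j => if j ∈ E then (u j + s * (u' - u) j)⁻¹ else 0) ∈ reciprocalLocus L E :=
        ⟨u + s • (u' - u), L.add_mem hu (L.smul_mem s (L.sub_mem hu' hu)), hs,
          fun j hj => by simp [hj], fun j hj => by simp [hj]⟩
      have h0 := mem_vanishingIdeal_iff.1 hfg _ hz
      rw [aeval_eq_eval, map_mul] at h0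
      rw [heval f s _ hs (fun j hj => if_pos hj) (fun j hj => if_neg hj),
        heval g s _ hs (fun j hj => if_pos hj) (fun j hj => if_neg hj),
        mul_mul_mul_comm (∏ j ∈ E, _), h0, mul_zero, mul_zero]
    · push Not at hs
      obtain ⟨j, hj, hj0⟩ := hs
      rw [Finset.prod_eq_zero hj hj0, zero_mul]
  rcases mul_eq_zero.1 hzero with h | h
  · exact lineProd_ne_zero (fun j hj => Or.inl (hu0 j hj)) h
  rcases mul_eq_zero.1 h with h | h
  · have := heval f 0 x (fun j hj => by simpa using hu0 j hj) (fun j hj => by simpa using hxu j hj) hxE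
    rw [h, Polynomial.eval_zero, eq_comm, mul_eq_zero, Finset.prod_eq_zero_iff] at this
    rcases this with ⟨j, hj, hj0⟩ | this
    · exact hu0 j hj (by simpa using eq_zero_of_pow_eq_zero hj0)
    · exact hfx this
  · have := heval g 1 y (fun j hj => by simpa using hu0' j hj) (fun j hj => by simpa using hyu j hj) hyE
    rw [h, Polynomial.eval_zero, eq_comm, mul_eq_zero, Finset.prod_eq_zero_iff] at this
    rcases this with ⟨j, hj, hj0⟩ | this
    · exact hu0' j hj (by simpa using eq_zero_of_pow_eq_zero hj0)
    · exact hgy this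

end Vanishing

/-! ### Circuits of a generic matrix, and the numerators of the minors. -/

section Circuits

variable {K : Type*} [Field K] {d n : ℕ}

theorem mem_costSpace_iff {A : Matrix (Fin d) (Fin n) K} {c u : Fin n → K} :
    u ∈ costSpace A c ↔ ∃ (s : K) (y : Fin d → K), u = s • c + Matrix.vecMul y A := by
  rw [costSpace, Submodule.mem_span_insert]
  refine exists_congr fun s => ?_
  rw [← range_vecMulLinear]
  simp

theorem forall_costSpace_dotProduct_eq_zero_iff {A : Matrix (Fin d) (Fin n) K} {c w : Fin n → K} :
    (∀ u ∈ costSpace A c, w ⬝ᵥ u = 0) ↔ A.mulVec w = 0 ∧ w ⬝ᵥ c = 0 := by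
  constructor
  · intro h
    refine ⟨?_, h c (Submodule.subset_span (Set.mem_insert _ _))⟩
    ext k
    rw [Matrix.mulVec, dotProduct_comm]
    exact h _ (Submodule.subset_span (Set.mem_insert_of_mem _ ⟨k, rfl⟩))
  · rintro ⟨h1, h2⟩ u hu
    obtain ⟨s, y, rfl⟩ := mem_costSpace_iff.1 hu
    rw [dotProduct_add, dotProduct_smul, h2, smul_zero, zero_add, dotProduct_comm,
      ← Matrix.dotProduct_mulVec, h1, dotProduct_zero]

theorem centralSheet_eq_reciprocalLocus (A : Matrix (Fin d) (Fin n) K) (c : Fin n → K) :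
    centralSheet A c = reciprocalLocus (costSpace A c) Finset.univ := by
  ext x
  simp [centralSheet, reciprocalLocus, funext_iff]

/-- The cofactor of column `k` in the submatrix of `A` with columns `e`. -/
def cofactor (A : Matrix (Fin d) (Fin n) K) (e : Fin (d + 1) ↪o Fin n) (k : Fin (d + 1)) : K :=
  (-1) ^ (d + (k : ℕ)) * (A.submatrix id (e ∘ k.succAbove)).det

/-- The linear relation among the columns `e` of `A` that is given by the maximal minors. -/
def circuitVec (A : Matrix (Fin d) (Fin n) K) (e : Fin (d + 1) ↪o Fin n) : Fin n → K :=
  Function.extend e (cofactor A e) 0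

theorem circuitVec_apply (A : Matrix (Fin d) (Fin n) K) (e : Fin (d + 1) ↪o Fin n)
    (k : Fin (d + 1)) : circuitVec A e (e k) = cofactor A e k :=
  e.injective.extend_apply _ _ _

theorem circuitVec_eq_zero (A : Matrix (Fin d) (Fin n) K) {e : Fin (d + 1) ↪o Fin n}
    {j : Fin n} (hj : j ∉ Finset.univ.map e.toEmbedding) : circuitVec A e j = 0 := by
  refine Function.extend_apply' _ _ _ fun ⟨k, hk⟩ => hj ?_
  simp [← hk]

theorem circuitVec_ne_zero {A : Matrix (Fin d) (Fin n) K} (hA : IsGenericMatrix A)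
    {e : Fin (d + 1) ↪o Fin n} {j : Fin n} (hj : j ∈ Finset.univ.map e.toEmbedding) :
    circuitVec A e j ≠ 0 := by
  obtain ⟨k, -, rfl⟩ := Finset.mem_map.1 hj
  rw [RelEmbedding.coe_toEmbedding, circuitVec_apply, cofactor]
  exact mul_ne_zero (pow_ne_zero _ (by simp)) (hA ((Fin.succAboveOrderEmb k).trans e))

/-- Each entry is the Laplace expansion, along the last row, of a determinant in which row `i` of
`A` is repeated. -/
theorem mulVec_circuitVec (A : Matrix (Fin d) (Fin n) K) (e : Fin (d + 1) ↪o Fin n) :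
    A.mulVec (circuitVec A e) = 0 := by
  ext i
  have h1 : (A.mulVec (circuitVec A e)) i = ∑ k, A i (e k) * cofactor A e k := by
    rw [Matrix.mulVec, dotProduct, ← Finset.sum_subset (Finset.subset_univ
      (Finset.univ.map e.toEmbedding)) fun j _ hj => by rw [circuitVec_eq_zero A hj, mul_zero],
      Finset.sum_map]
    exact Finset.sum_congr rfl fun k _ => by
      rw [RelEmbedding.coe_toEmbedding, circuitVec_apply]
  set M : Matrix (Fin (d + 1)) (Fin (d + 1)) K :=
    Matrix.of (Fin.snoc (fun k j => A k (e j)) fun j => A i (e j)) with hM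
  have hdet : M.det = 0 := by
    refine Matrix.det_zero_of_row_eq (Fin.castSucc_lt_last i).ne ?_
    ext j
    simp [hM]
  rw [Pi.zero_apply, h1, ← hdet, Matrix.det_succ_row M (Fin.last d)]
  refine Finset.sum_congr rfl fun k _ => ?_
  have h2 : M.submatrix (Fin.last d).succAbove k.succAbove =
      A.submatrix id (e ∘ k.succAbove) := by
    ext a b
    simp [hM]
  rw [h2, cofactor]
  simp only [hM, Matrix.of_apply, Fin.snoc_last, Fin.val_last]
  ring

theorem eq_zero_of_mulVec_eq_zero {A : Matrix (Fin d) (Fin n) K} (hA : IsGenericMatrix A)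
    (hdn : d ≤ n) {w : Fin n → K} (hw : A.mulVec w = 0) {S : Finset (Fin n)} (hS : S.card ≤ d)
    (hwS : ∀ j ∉ S, w j = 0) : w = 0 := by
  obtain ⟨T, hST, hT⟩ := Finset.exists_superset_card_eq hS (by simpa using hdn)
  set e := T.orderEmbOfFin hT with he
  have hmem : ∀ j, j ∈ T → ∃ k, e k = j := fun j hj => by
    have : j ∈ Set.range e := by rw [he, Finset.range_orderEmbOfFin]; exact hj
    exact this
  have h0 : (A.submatrix id e).mulVec (w ∘ e) = 0 := by
    rw [← hw]
    ext i
    rw [Matrix.mulVec, Matrix.mulVec, dotProduct, dotProduct,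
      ← Finset.sum_subset (Finset.subset_univ (Finset.univ.map e.toEmbedding)), Finset.sum_map]
    · rfl
    · intro j _ hj
      rw [hwS j fun hjS => ?_, mul_zero]
      obtain ⟨k, rfl⟩ := hmem j (hST hjS)
      simp at hj
  have h1 := Matrix.eq_zero_of_mulVec_eq_zero (hA e) h0
  ext j
  by_cases hj : j ∈ T
  · obtain ⟨k, rfl⟩ := hmem j hj
    exact congrFun h1 k
  · exact hwS j fun h => hj (hST h)

/-- The circuit polynomial of the columns `e` of `A`. -/
def circuitPoly (A : Matrix (Fin d) (Fin n) K) (e : Fin (d + 1) ↪o Fin n) :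
    MvPolynomial (Fin n) K :=
  relationPoly (Finset.univ.map e.toEmbedding) (circuitVec A e)

/-- Genericity makes every cofactor nonzero, so for each `k` some term of the circuit polynomial is
free of `X (e k)`. This makes the fraction in `det_stackInv_submatrix` reduced. -/
theorem isRelPrime_circuitPoly {A : Matrix (Fin d) (Fin n) K} (hA : IsGenericMatrix A)
    (e : Fin (d + 1) ↪o Fin n) :
    IsRelPrime (circuitPoly A e) (∏ k, (X (e k) : MvPolynomial (Fin n) K)) := by
  refine IsRelPrime.prod_right fun k _ => ?_
  refine ((Irreducible.isRelPrime_iff_not_dvd (X_prime (R := K)).irreducible).2 fun hdvd => ?_).symm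
  have hk : e k ∈ Finset.univ.map e.toEmbedding := by simp
  have hc := coeff_relationPoly (circuitVec A e) hk
  refine circuitVec_ne_zero hA hk ?_
  rw [← hc]
  rw [X_dvd_iff_modMonomial_eq_zero] at hdvd
  have h := congrArg (coeff (sqfreeExp ((Finset.univ.map e.toEmbedding).erase (e k)))) hdvd
  rwa [coeff_modMonomial_of_not_le, coeff_zero] at h
  intro hle
  have := hle (e k)
  rw [sqfreeExp_apply] at this
  simp at this

theorem det_stackInv_submatrix (A : Matrix (Fin d) (Fin n) K) (e : Fin (d + 1) ↪o Fin n) :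
    ((stackInv A).submatrix id e).det =
      algebraMap (MvPolynomial (Fin n) K) (FractionRing (MvPolynomial (Fin n) K))
        (circuitPoly A e) / algebraMap (MvPolynomial (Fin n) K) _ (∏ k, X (e k)) := by
  have hX : ∀ j, algebraMap (MvPolynomial (Fin n) K) (FractionRing (MvPolynomial (Fin n) K))
      (X j) ≠ 0 := fun j => by
    rw [Ne, FaithfulSMul.algebraMap_eq_zero_iff]
    exact X_ne_zero j
  rw [eq_div_iff (by rw [map_prod]; exact Finset.prod_ne_zero_iff.2 fun k _ => hX _),
    Matrix.det_succ_row _ (Fin.last d), circuitPoly, relationPoly, map_sum, Finset.sum_map,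
    Finset.sum_mul]
  refine Finset.sum_congr rfl fun k _ => ?_
  have h2 : ((stackInv A).submatrix id e).submatrix (Fin.last d).succAbove k.succAbove =
      (A.submatrix id (e ∘ k.succAbove)).map
        ((algebraMap (MvPolynomial (Fin n) K) (FractionRing (MvPolynomial (Fin n) K))).comp C) := by
    ext a b
    simp [stackInv]
  have h3 : (Finset.univ.map e.toEmbedding).erase (e k) =
      (Finset.univ.erase k).map e.toEmbedding := by
    rw [Finset.map_erase]; rfl
  rw [h2, ← RingHom.mapMatrix_apply, ← RingHom.map_det, RelEmbedding.coe_toEmbedding,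
    monomial_sqfreeExp, h3, Finset.prod_map, circuitVec_apply, cofactor,
    ← Finset.mul_prod_erase Finset.univ _ (Finset.mem_univ k)]
  simp only [stackInv, Matrix.submatrix_apply, id, Matrix.of_apply, Fin.snoc_last, Fin.val_last,
    map_mul, map_pow, map_neg, map_one, RingHom.comp_apply, RelEmbedding.coe_toEmbedding]
  have := hX (e k)
  field_simp

theorem associated_num_det {A : Matrix (Fin d) (Fin n) K} (hA : IsGenericMatrix A)
    (e : Fin (d + 1) ↪o Fin n) :
    Associated (IsFractionRing.num (MvPolynomial (Fin n) K) ((stackInv A).submatrix id e).det)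
      (circuitPoly A e) := by
  have hne : (∏ k, X (e k) : MvPolynomial (Fin n) K) ≠ 0 :=
    Finset.prod_ne_zero_iff.2 fun k _ => X_ne_zero _
  refine (IsFractionRing.num_den_unique (MvPolynomial (Fin n) K) _ (circuitPoly A e)
    ⟨_, mem_nonZeroDivisors_of_ne_zero hne⟩ (isRelPrime_circuitPoly hA e) ?_).1
  rw [det_stackInv_submatrix, IsFractionRing.mk'_eq_div]

theorem pieceIdeal_eq {A : Matrix (Fin d) (Fin n) K} (hA : IsGenericMatrix A) (i : Fin n) :
    pieceIdeal A i =
      Ideal.span {f | ∃ e : Fin (d + 1) ↪o Fin n, (∀ k, e k < i) ∧ f = circuitPoly A e} ⊔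
        Ideal.span {f | ∃ j : Fin n, i < j ∧ f = X j} := by
  rw [pieceIdeal, numMinors]
  congr 1
  refine le_antisymm (Ideal.span_le.2 ?_) (Ideal.span_le.2 ?_)
  · rintro f ⟨e, rfl⟩
    have h := associated_num_det hA (e.trans (Fin.castLEOrderEmb i.isLt.le))
    exact Ideal.mem_of_dvd _ h.symm.dvd
      (Ideal.subset_span ⟨e.trans (Fin.castLEOrderEmb i.isLt.le), fun k => (e k).isLt, rfl⟩)
  · rintro f ⟨e, he, rfl⟩
    set e' : Fin (d + 1) ↪o Fin (i : ℕ) :=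
      OrderEmbedding.ofStrictMono (fun k => ⟨e k, he k⟩) (fun a b hab => e.strictMono hab) with he'
    have h := associated_num_det hA e
    exact Ideal.mem_of_dvd _ h.dvd (Ideal.subset_span ⟨e', rfl⟩)

end Circuits

/-! ### The piece ideals are the prime vanishing ideals of the piece sheets. -/

section Pieces

variable {K : Type*} [Field K] {d n : ℕ}

theorem pieceSheet_eq_reciprocalLocus (A : Matrix (Fin d) (Fin n) K) (i : Fin n) :
    pieceSheet A i = reciprocalLocus (costSpace A (Pi.single i 1)) (Finset.Iic i) := by
  set φ : Fin ((i : ℕ) + 1) → Fin n := Fin.castLE (Nat.succ_le_of_lt i.isLt) with hφ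
  have hφi : ∀ j, φ j ≤ i := fun j => Nat.lt_succ_iff.1 j.isLt
  have hsurj : ∀ j ≤ i, ∃ k, φ k = j := fun j hj => ⟨⟨j, Nat.lt_succ_iff.2 hj⟩, rfl⟩
  have hφlast : φ (Fin.last (i : ℕ)) = i := rfl
  have hφinj : Function.Injective φ := Fin.castLE_injective _
  have hcomp : ∀ (s : K) (y : Fin d → K) (j : Fin ((i : ℕ) + 1)),
      (s • (Pi.single i 1 : Fin n → K) + Matrix.vecMul y A) (φ j) =
        (s • (Pi.single (Fin.last (i : ℕ)) 1 : Fin ((i : ℕ) + 1) → K) +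
          Matrix.vecMul y (A.submatrix id φ)) j := by
    intro s y j
    have h : (Pi.single i 1 : Fin n → K) (φ j) =
        (Pi.single (Fin.last (i : ℕ)) 1 : Fin ((i : ℕ) + 1) → K) j := by
      rw [Pi.single_apply, Pi.single_apply]
      exact if_congr (by rw [← hφinj.eq_iff, hφlast]) rfl rfl
    rw [Pi.add_apply, Pi.add_apply, Pi.smul_apply, Pi.smul_apply, h]
    rfl
  ext x
  constructor
  · rintro ⟨y, ⟨u, hu, hu0, rfl⟩, hxy, hx0⟩
    obtain ⟨s, y, rfl⟩ := mem_costSpace_iff.1 hu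
    refine ⟨_, mem_costSpace_iff.2 ⟨s, y, rfl⟩, fun j hj => ?_, fun j hj => ?_, fun j hj => ?_⟩
    · obtain ⟨k, rfl⟩ := hsurj j (Finset.mem_Iic.1 hj)
      rw [hcomp]
      exact hu0 k
    · obtain ⟨k, rfl⟩ := hsurj j (Finset.mem_Iic.1 hj)
      rw [hcomp]
      exact hxy k
    · exact hx0 j (by simpa using hj)
  · rintro ⟨u, hu, hu0, hx, hx0⟩
    obtain ⟨s, y, rfl⟩ := mem_costSpace_iff.1 hu
    refine ⟨_, ⟨_, mem_costSpace_iff.2 ⟨s, y, rfl⟩, fun j => ?_, rfl⟩, fun j => ?_, fun j hj => ?_⟩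
    · rw [← hcomp]
      exact hu0 _ (Finset.mem_Iic.2 (hφi j))
    · rw [← hcomp]
      exact hx _ (Finset.mem_Iic.2 (hφi j))
    · exact hx0 j (by simpa using hj)

theorem mem_vanishingIdeal_pieceSheet_iff {A : Matrix (Fin d) (Fin n) K} {i : Fin n}
    {g : MvPolynomial (Fin n) K} : g ∈ vanishingIdeal K (pieceSheet A i) ↔
      ∀ x ∈ reciprocalLocus (costSpace A (Pi.single i 1)) (Finset.Iic i), eval x g = 0 := by
  rw [pieceSheet_eq_reciprocalLocus, mem_vanishingIdeal_iff]
  simp only [aeval_eq_eval]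

theorem circuitPoly_mem_vanishingIdeal_pieceSheet (A : Matrix (Fin d) (Fin n) K) {i : Fin n}
    {e : Fin (d + 1) ↪o Fin n} (he : ∀ k, e k < i) :
    circuitPoly A e ∈ vanishingIdeal K (pieceSheet A i) := by
  rw [mem_vanishingIdeal_pieceSheet_iff]
  rintro x ⟨u, hu, hu0, hx, -⟩
  have hS : ∀ j ∈ Finset.univ.map e.toEmbedding, j ∈ Finset.Iic i := by
    intro j hj
    obtain ⟨k, -, rfl⟩ := Finset.mem_map.1 hj
    exact Finset.mem_Iic.2 (he k).le
  have hi : i ∉ Finset.univ.map e.toEmbedding := by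
    intro hj
    obtain ⟨k, -, hk⟩ := Finset.mem_map.1 hj
    exact (he k).ne hk
  refine eval_relationPoly (fun j hj => hu0 j (hS j hj)) (fun j hj => hx j (hS j hj)) ?_
  have h := forall_costSpace_dotProduct_eq_zero_iff.2 ⟨mulVec_circuitVec A e,
    show circuitVec A e ⬝ᵥ Pi.single i 1 = 0 by simp [circuitVec_eq_zero A hi]⟩ u hu
  rw [← h, dotProduct]
  exact Finset.sum_subset (Finset.subset_univ _) fun j _ hj => by
    rw [circuitVec_eq_zero A hj, zero_mul]

theorem pieceIdeal_le_vanishingIdeal {A : Matrix (Fin d) (Fin n) K} (hA : IsGenericMatrix A)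
    (i : Fin n) : pieceIdeal A i ≤ vanishingIdeal K (pieceSheet A i) := by
  rw [pieceIdeal_eq hA, sup_le_iff, Ideal.span_le, Ideal.span_le]
  refine ⟨?_, ?_⟩
  · rintro f ⟨e, he, rfl⟩
    exact circuitPoly_mem_vanishingIdeal_pieceSheet A he
  · rintro f ⟨j, hj, rfl⟩
    refine mem_vanishingIdeal_pieceSheet_iff.2 ?_
    rintro x ⟨u, -, -, -, hx⟩
    rw [eval_X, hx j (by simpa using hj)]

/-- The support of `w` has more than `d` elements, and any `d + 1` of them support a circuit. Under
the trivial valuation the leading index is the last index of the support, so it is enough to keep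
`m` among them. -/
theorem exists_circuit_of_mulVec_eq_zero {A : Matrix (Fin d) (Fin n) K} (hA : IsGenericMatrix A)
    (hdn : d ≤ n) {w : Fin n → K} (hw : A.mulVec w = 0) {m : Fin n}
    (hm : IsLeadingIndex (trivialValuation K) w m) :
    ∃ e : Fin (d + 1) ↪o Fin n, (∀ k, w (e k) ≠ 0) ∧ m ∈ Finset.univ.map e.toEmbedding ∧
      IsLeadingIndex (trivialValuation K) (circuitVec A e) m := by
  classical
  set S : Finset (Fin n) := Finset.univ.filter fun j => w j ≠ 0 with hS
  have hmS : m ∈ S := by simp [hS, hm.1]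
  have hcard : d < S.card := by
    by_contra hle
    refine hm.1 (congrFun (eq_zero_of_mulVec_eq_zero hA hdn hw (not_lt.1 hle) fun j hj => ?_) m)
    simpa [hS] using hj
  obtain ⟨T, hmT, hTS, hT⟩ := Finset.exists_subsuperset_card_eq (n := d + 1)
    (Finset.singleton_subset_iff.2 hmS) (by simp) hcard
  set e := T.orderEmbOfFin hT with he
  have hmap : Finset.univ.map e.toEmbedding = T := by
    ext j
    rw [← Finset.mem_coe, Finset.coe_map, Finset.coe_univ, Set.image_univ, ← Finset.mem_coe (s := T),
      ← Finset.range_orderEmbOfFin T hT]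
    rfl
  have hmT' : m ∈ Finset.univ.map e.toEmbedding := hmap ▸ Finset.singleton_subset_iff.1 hmT
  have hne := circuitVec_ne_zero hA hmT'
  refine ⟨e, fun k => ?_, hmT', hne, fun j => trivialValuation_le hne, fun j hj =>
    (trivialValuation_lt_iff hne).2 (circuitVec_eq_zero A fun hjT => ?_)⟩
  · exact (Finset.mem_filter.1 (hTS (T.orderEmbOfFin_mem hT k))).2
  · exact (Finset.mem_filter.1 (hTS (hmap ▸ hjT))).2
      ((trivialValuation_lt_iff hm.1).1 (hm.2.2 j hj))

theorem vanishingIdeal_le_pieceIdeal [CharZero K] {A : Matrix (Fin d) (Fin n) K}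
    (hA : IsGenericMatrix A) (hdn : d ≤ n) (i : Fin n) :
    vanishingIdeal K (pieceSheet A i) ≤ pieceIdeal A i := by
  refine subset_of_cancel_leadingTerm (S := (vanishingIdeal K (pieceSheet A i) :
    Set (MvPolynomial (Fin n) K))) fun g hg hg0 => ?_
  suffices h : ∃ r ∈ pieceIdeal A i,
      IsLeadingExp (trivialValuation K) r (MonomialOrder.lex.degree g) by
    obtain ⟨r, hr, hlead⟩ := h
    exact ⟨r, hr, hlead, fun c => Ideal.sub_mem _ hg
      (Ideal.mul_mem_left _ _ (pieceIdeal_le_vanishingIdeal hA i hr))⟩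
  rw [pieceIdeal_eq hA]
  by_cases hE : (MonomialOrder.lex.degree g).support ⊆ Finset.Iic i
  · rw [SetLike.mem_coe, pieceSheet_eq_reciprocalLocus] at hg
    obtain ⟨w, m, hw, hwE, hm, hwσ⟩ := isBroken_degree_of_mem_vanishingIdeal hg hg0 hE
    rw [forall_costSpace_dotProduct_eq_zero_iff] at hw
    -- The cost vector is the unit vector at `i`, so relations avoid `i`; this is why only circuits
    -- in indices below `i` are needed.
    have hwi : w i = 0 := by simpa using hw.2
    obtain ⟨e, hwe, hme, hme'⟩ := exists_circuit_of_mulVec_eq_zero hA hdn hw.1 hm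
    have hei : ∀ k, e k < i := fun k => by
      refine lt_of_le_of_ne ?_ fun h => hwe k (h ▸ hwi)
      by_contra hle
      exact hwe k (hwE _ (by simpa using hle))
    have hle : sqfreeExp ((Finset.univ.map e.toEmbedding).erase m) ≤ MonomialOrder.lex.degree g := by
      refine sqfreeExp_le fun j hj => ?_
      obtain ⟨hjm, hj⟩ := Finset.mem_erase.1 hj
      obtain ⟨k, -, rfl⟩ := Finset.mem_map.1 hj
      exact hwσ _ (hwe k) hjm
    obtain ⟨c, hc⟩ := exists_add_of_le hle
    refine ⟨monomial c 1 * circuitPoly A e, Ideal.mul_mem_left _ _ (Ideal.mem_sup_left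
      (Ideal.subset_span ⟨e, hei, rfl⟩)), ?_⟩
    rw [hc, add_comm]
    exact (hme'.isLeadingExp hme).monomial_mul c
  -- The leading monomial involves a variable beyond `i`, so it already lies in the piece ideal.
  · obtain ⟨j, hj, hji⟩ := Finset.not_subset.1 hE
    set b := MonomialOrder.lex.degree g with hb
    refine ⟨monomial b 1, Ideal.mem_sup_right ?_, ?_⟩
    · refine Ideal.mem_of_dvd _ (X_dvd_monomial.2 (Or.inr ?_) : X j ∣ monomial b (1 : K))
        (Ideal.subset_span ⟨j, by simpa using hji, rfl⟩)
      exact Finsupp.mem_support_iff.1 hj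
    · classical
      have h : (monomial b 1 : MvPolynomial (Fin n) K) ≠ 0 := by simp
      have := isLeadingExp_degree h
      rwa [MonomialOrder.degree_monomial, if_neg one_ne_zero] at this

theorem exists_row_ne_zero {A : Matrix (Fin d) (Fin n) K} (hA : IsGenericMatrix A) (hd : 1 ≤ d)
    (hdn : d ≤ n) (j : Fin n) : ∃ k, A k j ≠ 0 := by
  by_contra! h
  refine one_ne_zero (α := K) ?_
  have := congrFun (eq_zero_of_mulVec_eq_zero hA hdn (w := Pi.single j 1) (S := {j}) ?_
    (by simpa using hd) fun k hk => ?_) j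
  · simp at this
  · ext k
    simp [h k]
  · exact Pi.single_eq_of_ne (by simpa using hk) _

theorem reciprocalLocus_piece_nonempty [CharZero K] {A : Matrix (Fin d) (Fin n) K}
    (hA : IsGenericMatrix A) (hd : 1 ≤ d) (hdn : d ≤ n) (i : Fin n) :
    (reciprocalLocus (costSpace A (Pi.single i 1)) (Finset.Iic i)).Nonempty := by
  refine reciprocalLocus_nonempty fun j _ => ?_
  obtain ⟨k, hk⟩ := exists_row_ne_zero hA hd hdn j
  exact ⟨A.row k, Submodule.subset_span (Set.mem_insert_of_mem _ ⟨k, rfl⟩), hk⟩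

theorem pieceIdeal_eq_vanishingIdeal [CharZero K] {A : Matrix (Fin d) (Fin n) K}
    (hA : IsGenericMatrix A) (hdn : d ≤ n) (i : Fin n) :
    pieceIdeal A i = vanishingIdeal K (pieceSheet A i) :=
  le_antisymm (pieceIdeal_le_vanishingIdeal hA i) (vanishingIdeal_le_pieceIdeal hA hdn i)

theorem isPrime_pieceIdeal [CharZero K] {A : Matrix (Fin d) (Fin n) K}
    (hA : IsGenericMatrix A) (hd : 1 ≤ d) (hdn : d ≤ n) (i : Fin n) : (pieceIdeal A i).IsPrime := by
  rw [pieceIdeal_eq_vanishingIdeal hA hdn, pieceSheet_eq_reciprocalLocus]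
  exact isPrime_vanishingIdeal_reciprocalLocus (reciprocalLocus_piece_nonempty hA hd hdn i)

theorem X_notMem_pieceIdeal [CharZero K] {A : Matrix (Fin d) (Fin n) K}
    (hA : IsGenericMatrix A) (hd : 1 ≤ d) (hdn : d ≤ n) (i : Fin n) : X i ∉ pieceIdeal A i := by
  obtain ⟨x, hx⟩ := reciprocalLocus_piece_nonempty hA hd hdn i
  intro h
  have h0 := mem_vanishingIdeal_pieceSheet_iff.1 (pieceIdeal_le_vanishingIdeal hA i h) x hx
  obtain ⟨u, -, hu0, hxu, -⟩ := hx
  rw [eval_X, hxu i (by simp), inv_eq_zero] at h0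
  exact hu0 i (by simp) h0

end Pieces

/-! ### The initial ideal as the intersection of the pieces. -/

section Degeneration

variable {K : Type*} [Field K] {d n : ℕ}

/-- The exponents of the entries of `degeneratingCost`. -/
def costExp (w : Fin (n - 1) → ℚ) : Fin n → ℚ :=
  fun j => if h : (j : ℕ) < n - 1 then w ⟨j, h⟩ else 0

theorem costExp_strictAnti {w : Fin (n - 1) → ℚ} (hw : StrictAnti w) (hwpos : ∀ j, 0 < w j) :
    StrictAnti (costExp w) := by
  intro i j hij
  have hi : (i : ℕ) < n - 1 := by have := j.isLt; have : (i : ℕ) < j := hij; omega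
  simp only [costExp, hi, dif_pos]
  split_ifs with hj
  · exact hw hij
  · exact hwpos _

theorem degeneratingCost_eq (w : Fin (n - 1) → ℚ) (j : Fin n) :
    degeneratingCost K w j = puiseuxMonomial (costExp w j) 1 := by
  rw [degeneratingCost, costExp]
  split_ifs
  · rfl
  · rfl

/-- The initial ideal of the central sheet of `A` with the degenerating cost vector. -/
def degIdeal (A : Matrix (Fin d) (Fin n) K) (w : Fin (n - 1) → ℚ) : Ideal (MvPolynomial (Fin n) K) :=
  initialIdeal (centralSheetIdeal (A.map (puiseuxC K)) (degeneratingCost K w))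

theorem coeff_puiseuxMonomial (q r : ℚ) (a : K) :
    (puiseuxMonomial q a : HahnSeries ℚ K).coeff r = if r = q then a else 0 := by
  change (HahnSeries.single q a).coeff r = _
  split_ifs with h
  · rw [h, HahnSeries.coeff_single_same]
  · exact HahnSeries.coeff_single_of_ne h

theorem puiseuxMonomial_mul (q r : ℚ) (a b : K) :
    puiseuxMonomial q a * puiseuxMonomial r b = puiseuxMonomial (q + r) (a * b) :=
  Subtype.ext HahnSeries.single_mul_single

theorem apply_eval {R S σ : Type*} [CommSemiring R] [CommSemiring S] (φ : R →+* S)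
    (x : σ → R) (p : MvPolynomial σ R) :
    φ (eval x p) = eval (fun j => φ (x j)) (MvPolynomial.map φ p) := by
  rw [eval_map, ← eval₂_id, eval₂_comp_left, RingHom.comp_id]
  rfl

theorem exists_pos_lt_sub {W : Fin n → ℚ} (hW : StrictAnti W) (i : Fin n) :
    ∃ ε : ℚ, 0 < ε ∧ ∀ j, i < j → ε < W i - W j := by
  by_cases h : (i : ℕ) + 1 < n
  · have h1 : W ⟨i + 1, h⟩ < W i := hW (Nat.lt_succ_self (i : ℕ))
    refine ⟨(W i - W ⟨i + 1, h⟩) / 2, by linarith, fun j hj => ?_⟩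
    have h2 : W j ≤ W ⟨i + 1, h⟩ := hW.antitone (Nat.succ_le_of_lt hj)
    linarith
  · refine ⟨1, one_pos, fun j hj => absurd j.isLt ?_⟩
    have : (i : ℕ) < j := hj
    omega

/-- Reductions of the inverses of units of the valuation ring. -/
theorem exists_inv_atZero_eq {r : puiseuxIntegers K} (hr : puiseuxAtZero K r ≠ 0) :
    ∃ s : puiseuxIntegers K, (s : puiseux K) = (r : puiseux K)⁻¹ ∧
      puiseuxAtZero K s = (puiseuxAtZero K r)⁻¹ := by
  have hv := puiseuxValuation_eq_one hr
  have hr0 : (r : puiseux K) ≠ 0 := fun h0 => by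
    rw [h0, map_zero] at hv
    exact zero_ne_one hv
  refine ⟨⟨(r : puiseux K)⁻¹, (puiseuxValuation_le_one_iff _).1 ?_⟩, rfl, ?_⟩
  · rw [map_inv₀, hv, inv_one]
  · refine eq_inv_of_mul_eq_one_left ?_
    rw [← map_mul, ← map_one (puiseuxAtZero K)]
    exact congrArg _ (Subtype.ext (inv_mul_cancel₀ hr0))

theorem exists_inv_atZero_eq_zero {x : puiseux K} (hx : x ∉ puiseuxIntegers K) :
    ∃ s : puiseuxIntegers K, (s : puiseux K) = x⁻¹ ∧ puiseuxAtZero K s = 0 := by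
  rw [← puiseuxValuation_le_one_iff, not_le] at hx
  have h : puiseuxValuation K x⁻¹ < 1 := by
    rw [map_inv₀]
    exact inv_lt_one_of_one_lt₀ hx
  refine ⟨⟨x⁻¹, (puiseuxValuation_le_one_iff _).1 h.le⟩, rfl, ?_⟩
  rwa [← puiseuxValuation_lt_one_iff_atZero]

/-- Every point of the piece is the reduction of a point of the sheet over Puiseux series. Scaling
the cost vector by `t ^ (-W i)` makes its entries before `i` vanish at `t = 0`, turns entry `i` into
`1`, and gives the later entries poles, whose reciprocals reduce to `0`. -/
theorem degIdeal_le_vanishingIdeal (A : Matrix (Fin d) (Fin n) K) {w : Fin (n - 1) → ℚ}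
    (hw : StrictAnti w) (hwpos : ∀ j, 0 < w j) (i : Fin n) :
    degIdeal A w ≤ vanishingIdeal K (pieceSheet A i) := by
  intro g hg
  obtain ⟨h, hJ, rfl⟩ := mem_initialIdeal_iff.1 hg
  refine mem_vanishingIdeal_pieceSheet_iff.2 ?_
  rintro x ⟨u, hu, hu0, hx, hx0⟩
  obtain ⟨s, y, rfl⟩ := mem_costSpace_iff.1 hu
  set W := costExp w with hWdef
  have hW : StrictAnti W := costExp_strictAnti hw hwpos
  obtain ⟨ε, hε, hεW⟩ := exists_pos_lt_sub hW i
  set a : Fin n → K := Matrix.vecMul y A with ha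
  -- The second monomial produces poles beyond `i` even if `s = 0`. The bound on `ε` keeps its
  -- exponent negative there, and `ε > 0` makes it vanish at `t = 0` up to `i`.
  set U : Fin n → puiseux K :=
    (puiseuxMonomial (-W i) s + puiseuxMonomial (ε - W i) 1) • degeneratingCost K w +
      Matrix.vecMul (fun k => puiseuxC K (y k)) (A.map (puiseuxC K)) with hU
  have hUmem : U ∈ costSpace (A.map (puiseuxC K)) (degeneratingCost K w) :=
    mem_costSpace_iff.2 ⟨_, _, rfl⟩
  have hUj : ∀ j, U j = puiseuxMonomial (W j - W i) s + puiseuxMonomial (W j - W i + ε) 1 +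
      puiseuxMonomial 0 (a j) := by
    intro j
    have h1 : Matrix.vecMul (fun k => puiseuxC K (y k)) (A.map (puiseuxC K)) j =
        puiseuxC K (a j) := (RingHom.map_vecMul (puiseuxC K) A y j).symm
    rw [hU, Pi.add_apply, Pi.smul_apply, smul_eq_mul, h1, degeneratingCost_eq, add_mul,
      puiseuxMonomial_mul, puiseuxMonomial_mul, mul_one, mul_one, neg_add_eq_sub,
      sub_add_eq_add_sub, add_comm ε, ← sub_add_eq_add_sub]
    rfl
  have hcoeff : ∀ j q, (U j : HahnSeries ℚ K).coeff q = (if q = W j - W i then s else 0) +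
      (if q = W j - W i + ε then 1 else 0) + if q = 0 then a j else 0 := by
    intro j q
    rw [hUj]
    change (puiseuxMonomial (W j - W i) s : HahnSeries ℚ K).coeff q +
      (puiseuxMonomial (W j - W i + ε) (1 : K) : HahnSeries ℚ K).coeff q +
      (puiseuxMonomial 0 (a j) : HahnSeries ℚ K).coeff q = _
    rw [coeff_puiseuxMonomial, coeff_puiseuxMonomial, coeff_puiseuxMonomial]
  clear_value U
  have hlift : ∀ j, U j ≠ 0 ∧ ∃ r : puiseuxIntegers K, (r : puiseux K) = (U j)⁻¹ ∧
      puiseuxAtZero K r = x j := by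
    intro j
    rcases le_or_gt j i with hji | hji
    · have hWji : 0 ≤ W j - W i := sub_nonneg.2 (hW.antitone hji)
      have hint : U j ∈ puiseuxIntegers K := fun q hq => by
        rw [hcoeff, if_neg (by linarith : q ≠ W j - W i), if_neg (by linarith), if_neg hq.ne]
        simp
      have hres : puiseuxAtZero K ⟨U j, hint⟩ =
          (s • (Pi.single i 1 : Fin n → K) + a) j := by
        change (U j : HahnSeries ℚ K).coeff 0 = _
        rw [hcoeff, if_neg (by linarith : (0 : ℚ) ≠ W j - W i + ε), if_pos rfl, add_zero,
          Pi.add_apply, Pi.smul_apply, Pi.single_apply, smul_eq_mul, mul_ite, mul_one, mul_zero]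
        congr 1
        refine if_congr ?_ rfl rfl
        rw [eq_comm, sub_eq_zero, hW.injective.eq_iff]
      have hne := hu0 j (Finset.mem_Iic.2 hji)
      rw [hx j (Finset.mem_Iic.2 hji), ← hres]
      rw [← hres] at hne
      have hex := exists_inv_atZero_eq (r := ⟨U j, hint⟩) hne
      refine ⟨fun h0 => hne ?_, hex⟩
      have h1 : (⟨U j, hint⟩ : puiseuxIntegers K) = 0 := Subtype.ext h0
      rw [h1, map_zero]
    · have hlt := hεW j hji
      have hnot : U j ∉ puiseuxIntegers K := fun hint => by
        have h1 := hint (W j - W i + ε) (by linarith)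
        rw [hcoeff, if_neg (by linarith), if_pos rfl, if_neg (by linarith)] at h1
        simp at h1
      rw [hx0 j (by simpa using hji)]
      refine ⟨fun h0 => hnot ?_, exists_inv_atZero_eq_zero hnot⟩
      rw [h0]
      exact zero_mem _
  choose hU0 r hr hrx using hlift
  rw [centralSheetIdeal, mem_vanishingIdeal_iff] at hJ
  have h0 := hJ (fun j => (U j)⁻¹) ⟨U, hUmem, hU0, rfl⟩
  rw [aeval_eq_eval] at h0
  have h1 : eval r h = 0 := by
    refine (puiseuxIntegers K).subtype_injective ?_
    rw [apply_eval, map_zero, ← h0]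
    simp only [Subring.subtype_apply, hr]
  have h2 := congrArg (puiseuxAtZero K) h1
  rw [apply_eval, map_zero] at h2
  simpa only [hrx] using h2

theorem relationPoly_insert_of_eq_zero {A ι : Type*} [CommSemiring A] [Fintype ι] [LinearOrder ι]
    {S : Finset ι} {m : ι} (hm : m ∉ S) {q : ι → A} (hq : q m = 0) :
    relationPoly (insert m S) q = X m * relationPoly S q := by
  rw [relationPoly, Finset.sum_insert hm, hq, map_zero, zero_add, relationPoly, Finset.mul_sum]
  refine Finset.sum_congr rfl fun i hi => ?_
  have him : m ≠ i := fun h => hm (h ▸ hi)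
  rw [Finset.erase_insert_of_ne him, sqfreeExp, Finset.sum_insert
    (fun h => hm (Finset.mem_of_mem_erase h)), ← sqfreeExp, X, monomial_mul, one_mul]

theorem relationPoly_mul {A ι : Type*} [CommSemiring A] [Fintype ι] [LinearOrder ι]
    (S : Finset ι) (c : A) (q : ι → A) :
    relationPoly S (fun j => c * q j) = C c * relationPoly S q := by
  simp only [relationPoly, Finset.mul_sum, C_mul_monomial]

/-- Let `q` be the given circuit and `p` one with `m` in place of `e 0`. Some combination of them is
orthogonal to the cost vector. Among the costs involved that of `m` has the smallest exponent, so at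
`t = 0` the combination becomes `p m` times `q`. Clearing denominators over the support enlarged by
`m` supplies the factor `X m`. -/
theorem X_mul_circuitPoly_mem_degIdeal {A : Matrix (Fin d) (Fin n) K} (hA : IsGenericMatrix A)
    {w : Fin (n - 1) → ℚ} (hw : StrictAnti w) (hwpos : ∀ j, 0 < w j) {e : Fin (d + 1) ↪o Fin n}
    {m : Fin n} (hm : ∀ k, e k < m) : X m * circuitPoly A e ∈ degIdeal A w := by
  set W := costExp w with hWdef
  have hW : StrictAnti W := costExp_strictAnti hw hwpos
  set S := Finset.univ.map e.toEmbedding with hS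
  set q := circuitVec A e with hq
  have hSm : ∀ j ∈ S, j < m := fun j hj => by
    obtain ⟨k, -, rfl⟩ := Finset.mem_map.1 hj
    exact hm k
  have hmS : m ∉ S := fun h => lt_irrefl _ (hSm m h)
  have he0 : e 0 ∈ S := by simp [hS]
  have hT : (insert m (S.erase (e 0))).card = d + 1 := by
    rw [Finset.card_insert_of_notMem fun h => hmS (Finset.mem_of_mem_erase h),
      Finset.card_erase_of_mem he0]
    simp [hS]
  set e' := (insert m (S.erase (e 0))).orderEmbOfFin hT with he'
  set p := circuitVec A e' with hp
  have hmap : Finset.univ.map e'.toEmbedding = insert m (S.erase (e 0)) := by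
    ext j
    rw [← Finset.mem_coe, Finset.coe_map, Finset.coe_univ, Set.image_univ,
      ← Finset.mem_coe (s := insert m _), ← Finset.range_orderEmbOfFin _ hT]
    rfl
  have hpm : p m ≠ 0 := circuitVec_ne_zero hA (by rw [hmap]; exact Finset.mem_insert_self _ _)
  have hp0 : ∀ j ∉ insert m S, p j = 0 := fun j hj => circuitVec_eq_zero A (by
    rw [hmap]
    exact fun h => hj (Finset.insert_subset_insert _ (Finset.erase_subset _ _) h))
  have hq0 : ∀ j ∉ S, q j = 0 := fun j hj => circuitVec_eq_zero A hj
  have hτ : ∀ j, ∃ τ : puiseuxIntegers K, (j ≤ m → (τ : puiseux K) =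
      puiseuxMonomial (W j - W m) 1) ∧ puiseuxAtZero K τ = if j = m then 1 else 0 := by
    intro j
    by_cases hjm : j ≤ m
    · refine ⟨⟨puiseuxMonomial (W j - W m) 1, fun r hr => ?_⟩, fun _ => rfl, ?_⟩
      · have := hW.antitone hjm
        rw [coeff_puiseuxMonomial, if_neg]
        linarith
      · change (puiseuxMonomial (W j - W m) (1 : K) : HahnSeries ℚ K).coeff 0 = _
        rw [coeff_puiseuxMonomial]
        refine if_congr ?_ rfl rfl
        rw [eq_comm, sub_eq_zero, hW.injective.eq_iff]
    · exact ⟨0, fun h => absurd h hjm, by rw [map_zero, if_neg fun h => hjm h.le]⟩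
  choose τ hτm hτ0 using hτ
  -- This is the pairing with the cost vector divided by `t ^ W m`; it is integral and reduces to
  -- the entry at `m`.
  set γ : (Fin n → K) → puiseuxIntegers K :=
    fun v => ∑ j ∈ insert m S, puiseuxIntegersC K (v j) * τ j with hγ
  have hγ0 : ∀ v, puiseuxAtZero K (γ v) = v m := by
    intro v
    rw [hγ, map_sum, Finset.sum_eq_single_of_mem m (Finset.mem_insert_self _ _)]
    · rw [map_mul, hτ0, if_pos rfl, mul_one, puiseuxAtZero_puiseuxIntegersC]
    · intro j _ hj
      rw [map_mul, hτ0, if_neg hj, mul_zero]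
  have hγc : ∀ v : Fin n → K, (∀ j ∉ insert m S, v j = 0) →
      (fun j => puiseuxC K (v j)) ⬝ᵥ degeneratingCost K w =
        puiseuxMonomial (W m) 1 * (γ v : puiseux K) := by
    intro v hv
    rw [dotProduct, ← Finset.sum_subset (Finset.subset_univ (insert m S)) fun j _ hj => by
      rw [hv j hj, map_zero, zero_mul], hγ, AddSubmonoidClass.coe_finsetSum, Finset.mul_sum]
    refine Finset.sum_congr rfl fun j hj => ?_
    have hjm : j ≤ m := by
      rcases Finset.mem_insert.1 hj with rfl | hj
      · exact le_rfl
      · exact (hSm j hj).le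
    rw [degeneratingCost_eq, Subring.coe_mul, hτm j hjm, mul_left_comm, puiseuxMonomial_mul,
      add_sub_cancel, mul_one]
    rfl
  set V : Fin n → puiseuxIntegers K := fun j =>
    γ p * puiseuxIntegersC K (q j) - γ q * puiseuxIntegersC K (p j) with hV
  have hVeq : (fun j => (V j : puiseux K)) = (γ p : puiseux K) • (fun j => puiseuxC K (q j)) -
      (γ q : puiseux K) • (fun j => puiseuxC K (p j)) := rfl
  have hker : ∀ v : Fin n → K, A.mulVec v = 0 →
      (A.map (puiseuxC K)).mulVec (fun j => puiseuxC K (v j)) = 0 := by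
    intro v hv
    ext1 k
    rw [Pi.zero_apply, ← map_zero (puiseuxC K), ← Pi.zero_apply (M := fun _ => K) k, ← hv]
    exact (RingHom.map_mulVec (puiseuxC K) A v k).symm
  have hperp := (forall_costSpace_dotProduct_eq_zero_iff (A := A.map (puiseuxC K))
    (c := degeneratingCost K w) (w := fun j => (V j : puiseux K))).2 ⟨by
      rw [hVeq, Matrix.mulVec_sub, Matrix.mulVec_smul, Matrix.mulVec_smul,
        hker q (mulVec_circuitVec A e), hker p (mulVec_circuitVec A e'), smul_zero, smul_zero,
        sub_zero], by
      rw [hVeq, sub_dotProduct, smul_dotProduct, smul_dotProduct, hγc p hp0,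
        hγc q (fun j hj => hq0 j fun h => hj (Finset.mem_insert_of_mem h)), smul_eq_mul,
        smul_eq_mul]
      ring⟩
  have hred : C (p m) * (X m * circuitPoly A e) ∈ degIdeal A w := by
    refine mem_initialIdeal_iff.2 ⟨relationPoly (insert m S) V, ?_, ?_⟩
    · rw [map_relationPoly, centralSheetIdeal, mem_vanishingIdeal_iff]
      rintro x ⟨u, hu, hu0, rfl⟩
      rw [aeval_eq_eval]
      refine eval_relationPoly (u := u) (fun j _ => hu0 j) (fun j _ => rfl) ?_
      rw [← hperp u hu, dotProduct]
      refine Finset.sum_subset (Finset.subset_univ _) fun j _ hj => ?_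
      have : V j = 0 := by
        rw [hV]
        simp only [hp0 j hj, hq0 j fun h => hj (Finset.mem_insert_of_mem h), map_zero, mul_zero,
          sub_zero]
      simp [this]
    · have h1 : (fun j => puiseuxAtZero K (V j)) = fun j => p m * q j := by
        ext j
        rw [hV, map_sub, map_mul, map_mul, hγ0, hγ0, hq0 m hmS, zero_mul, sub_zero,
          puiseuxAtZero_puiseuxIntegersC]
      rw [map_relationPoly, h1, relationPoly_mul, relationPoly_insert_of_eq_zero hmS (hq0 m hmS)]
      rfl
  have := (degIdeal A w).mul_mem_left (C (p m)⁻¹) hred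
  rwa [← mul_assoc, ← C_mul, inv_mul_cancel₀ hpm, C_1, one_mul] at this

/-- Modulo the initial ideal, `g` is pushed into ideals generated by fewer and fewer of the last
variables, until none is left. -/
theorem iInf_pieceIdeal_le_degIdeal [CharZero K] {A : Matrix (Fin d) (Fin n) K}
    (hA : IsGenericMatrix A) (hd : 1 ≤ d) (hdn : d < n) {w : Fin (n - 1) → ℚ}
    (hw : StrictAnti w) (hwpos : ∀ j, 0 < w j) :
    ⨅ i : {i : Fin n // d ≤ (i : ℕ)}, pieceIdeal A i ≤ degIdeal A w := by
  intro g hg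
  have hg' : ∀ i : Fin n, d ≤ (i : ℕ) → g ∈ pieceIdeal A i := fun i hi =>
    (Submodule.mem_iInf _).1 hg ⟨i, hi⟩
  have key : ∀ k, d ≤ k → k < n →
      g ∈ degIdeal A w ⊔ Ideal.span {f | ∃ j : Fin n, k < (j : ℕ) ∧ f = X j} := by
    intro k hdk
    induction k, hdk using Nat.le_induction with
    | base =>
      intro hk
      have h := hg' ⟨d, hk⟩ le_rfl
      rw [pieceIdeal_eq hA] at h
      refine sup_le_sup_right (α := Ideal (MvPolynomial (Fin n) K)) (Ideal.span_le.2 ?_) _ h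
      rintro f ⟨e, he, rfl⟩
      -- No circuit fits into the first `d` columns, so the first piece ideal is generated by
      -- variables only.
      have hcard := Fintype.card_le_of_injective (fun k => (⟨e k, he k⟩ : Fin d)) fun a b hab =>
        e.injective (Fin.ext (by simpa [Fin.ext_iff] using hab))
      simp at hcard
    | succ k hdk ih =>
      intro hk
      set m : Fin n := ⟨k + 1, hk⟩ with hm
      have hle : degIdeal A w ≤ pieceIdeal A m :=
        (degIdeal_le_vanishingIdeal A hw hwpos m).trans (vanishingIdeal_le_pieceIdeal hA hdn.le m)
      have hspan : Ideal.span {f | ∃ j : Fin n, k + 1 < (j : ℕ) ∧ f = X j} ≤ pieceIdeal A m := by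
        rw [pieceIdeal_eq hA]
        exact le_sup_right
      have hsub : Ideal.span {f : MvPolynomial (Fin n) K | ∃ j : Fin n, k < (j : ℕ) ∧ f = X j} ≤
          Ideal.span {X m} ⊔ Ideal.span {f | ∃ j : Fin n, k + 1 < (j : ℕ) ∧ f = X j} := by
        refine Ideal.span_le.2 ?_
        rintro f ⟨j, hj, rfl⟩
        rcases Nat.lt_or_ge (k + 1) j with h | h
        · exact Ideal.mem_sup_right (Ideal.subset_span ⟨j, h, rfl⟩)
        · have : j = m := Fin.ext (by simp [hm]; omega)
          exact Ideal.mem_sup_left (this ▸ Ideal.mem_span_singleton_self _)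
      obtain ⟨g₁, hg₁, y, hy, rfl⟩ := Submodule.mem_sup.1 (ih (by omega))
      obtain ⟨z, hz, r, hr, rfl⟩ := Submodule.mem_sup.1 (hsub hy)
      obtain ⟨q, rfl⟩ := Ideal.mem_span_singleton'.1 hz
      have hqm : q * X m ∈ pieceIdeal A m := by
        have h1 := Ideal.sub_mem _ (Ideal.sub_mem _ (hg' m (by simp [hm]; omega)) (hle hg₁))
          (hspan hr)
        convert h1 using 1
        ring
      -- Primality cancels `X m`. The circuit part of `q`, times `X m`, then lies in the initial
      -- ideal, and the rest involves only later variables.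
      have hq := ((isPrime_pieceIdeal hA hd hdn.le m).mem_or_mem hqm).resolve_right
        (X_notMem_pieceIdeal hA hd hdn.le m)
      rw [pieceIdeal_eq hA] at hq
      obtain ⟨q₁, hq₁, q₂, hq₂, rfl⟩ := Submodule.mem_sup.1 hq
      have hX : q₁ * X m ∈ degIdeal A w := by
        have : Ideal.span {f | ∃ e : Fin (d + 1) ↪o Fin n, (∀ k, e k < m) ∧ f = circuitPoly A e} ≤
            (degIdeal A w).colon {X m} := by
          refine Ideal.span_le.2 ?_
          rintro f ⟨e, he, rfl⟩
          rw [SetLike.mem_coe, Submodule.mem_colon_singleton, smul_eq_mul, mul_comm]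
          exact X_mul_circuitPoly_mem_degIdeal hA hw hwpos he
        simpa [Submodule.mem_colon_singleton] using this hq₁
      rw [add_mul, add_assoc (q₁ * X m), ← add_assoc g₁]
      exact Submodule.add_mem_sup (Ideal.add_mem _ hg₁ hX)
        (Ideal.add_mem _ (Ideal.mul_mem_right _ _ hq₂) hr)
  have h := key (n - 1) (by omega) (by omega)
  have hbot : Ideal.span {f : MvPolynomial (Fin n) K | ∃ j : Fin n, n - 1 < (j : ℕ) ∧ f = X j} = ⊥ := by
    rw [Ideal.span_eq_bot]
    rintro f ⟨j, hj, -⟩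
    have := j.isLt
    omega
  rwa [hbot, sup_bot_eq] at h

end Degeneration

end

theorem theorem4p6 {K : Type*} [Field K] [CharZero K] {d n : ℕ} (hd : 1 ≤ d) (hdn : d < n)
    (A : Matrix (Fin d) (Fin n) K) (hA : A.rank = d)
    (w : Fin (n - 1) → ℚ) (hw : StrictAnti w) (hwpos : ∀ j, 0 < w j) :
    (initialIdeal (centralSheetIdeal (A.map (puiseuxC K)) (degeneratingCost K w))).IsRadical ∧
    (IsGenericMatrix A →
      initialIdeal (centralSheetIdeal (A.map (puiseuxC K)) (degeneratingCost K w)) =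
          ⨅ i : {i : Fin n // d ≤ (i : ℕ)}, pieceIdeal A i ∧
      (∀ i : Fin n, d ≤ (i : ℕ) →
        (pieceIdeal A i).IsPrime ∧ pieceIdeal A i = vanishingIdeal K (pieceSheet A i)) ∧
      initialIdeal (centralSheetIdeal (A.map (puiseuxC K)) (degeneratingCost K w)) =
          vanishingIdeal K (⋃ i : {i : Fin n // d ≤ (i : ℕ)}, pieceSheet A i)) := by
  constructor
  · rw [centralSheetIdeal, centralSheet_eq_reciprocalLocus]
    exact isRadical_initialIdeal_reciprocalLocus _
  intro hgen
  have hle : ∀ i : Fin n, degIdeal A w ≤ pieceIdeal A i := fun i =>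
    (degIdeal_le_vanishingIdeal A hw hwpos i).trans (vanishingIdeal_le_pieceIdeal hgen hdn.le i)
  have heq : degIdeal A w = ⨅ i : {i : Fin n // d ≤ (i : ℕ)}, pieceIdeal A i :=
    le_antisymm (le_iInf fun i => hle i) (iInf_pieceIdeal_le_degIdeal hgen hd hdn hw hwpos)
  refine ⟨heq, fun i _ => ⟨isPrime_pieceIdeal hgen hd hdn.le i,
    pieceIdeal_eq_vanishingIdeal hgen hdn.le i⟩, heq.trans ?_⟩
  ext g
  simp only [Submodule.mem_iInf, pieceIdeal_eq_vanishingIdeal hgen hdn.le, mem_vanishingIdeal_iff,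
    Set.mem_iUnion]
  exact ⟨fun h x ⟨i, hi⟩ => h i x hi, fun h i x hx => h x ⟨i, hx⟩⟩
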